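/- **Proposition 3.5.** For integers $n\ge 1$, $m\ge 0$ the preferential attachment graph $\mathrm{PAG}(n,m)$ is the following random multigraph on $n$ fixed nodes $v_1,\dots,v_n$. Extend the sequence $v_1\dots v_n$ one element at a time, each time picking an element of the current sequence uniformly at random and appending a copy of it at the end, until $2m$ elements have been added; in the resulting sequence $v_1\dots v_n v_{n+1}\dots v_{n+2m}$ join $v_{n+2j-1}$ to $v_{n+2j}$ by an edge for $j=1,\dots,m$ (loops and multiple edges may occur). For multigraphs $F$ and $G$ with $|V(F)|=k$ and $|V(G)|=n$, let $\mathrm{inj}(F,G)$ be the number of pairs $(\varphi,\psi)$ of injective maps $\varphi:V(F)\to V(G)$, $\psi:E(F)\to E(G)$ that preserve incidence (an edge with ends $u,v$ is mapped to an edge with ends $\varphi(u),\varphi(v)$), and let $t_{\rm inj}(F,G)=\mathrm{inj}(F,G)/(n)_k$, where $(n)_k=n(n-1)\cdots(n-k+1)$. For a symmetric function $W$ let $t(F,W)=\int_{[0,1]^{V(F)}}\prod_{ij\in E(F)}W(x_i,x_j)\,dx$, where parallel edges contribute with multiplicity. For $c\ge 0$ let $L_c(x,y)=c\,\ln x\,\ln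 y$. Let $c\ge 0$ and let $m(n)$ be nonnegative integers with $m(n)=\left(\tfrac c2+o(1)\right)n^2$ as $n\to\infty$. For every loopless multigraph $F$ with $k$ nodes of degrees $r_1,\dots,r_k$ and with $l$ edges, the integral $t(F,L_c)$ converges absolutely and $$t(F,L_c)=c^l\,r_1!\cdots r_k!.$$ If the random multigraphs $\mathrm{PAG}(n,m(n))$, $n=1,2,\dots$, are defined on a common probability space (with an arbitrary joint distribution), then with probability $1$, simultaneously for all finite loopless multigraphs $F$, $$t_{\rm inj}(F,\mathrm{PAG}(n,m(n)))\longrightarrow t(F,L_c)\qquad(n\to\infty).$$ -/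

import Mathlib

open Filter Topology MeasureTheory ProbabilityTheory

/-- A multigraph (loops and parallel edges allowed) with vertex set `V` and edge set `E`:
every edge has an unordered pair of endpoints, which coincide exactly for loops. -/
@[ext]
structure Multigraph (V E : Type*) where
  /-- the endpoints of an edge -/
  ends : E → Sym2 V

/-- Multigraphs on given vertex and edge sets carry the discrete σ-algebra. -/
instance Multigraph.instMeasurableSpace (V E : Type*) : MeasurableSpace (Multigraph V E) := ⊤

/-- No edge is a loop. -/
def Multigraph.IsLoopless {V E : Type*} (F : Multigraph V E) : Prop :=
  ∀ e, ¬ (F.ends e).IsDiag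

/-- The degree of a vertex: the number of edge ends at `v`, so a loop counts twice. -/
noncomputable def Multigraph.degree {V E : Type*} [DecidableEq V] [Fintype E]
    (F : Multigraph V E) (v : V) : ℕ :=
  ∑ e, (F.ends e).toMultiset.count v

/-- `inj(F, G)`: the number of pairs of injective maps `φ : V(F) → V(G)`, `ψ : E(F) → E(G)` that
preserve incidence, i.e. an edge with ends `u, v` goes to an edge with ends `φ u, φ v`. -/
noncomputable def Multigraph.inj {V E V' E' : Type*} (F : Multigraph V E) (G : Multigraph V' E') :
    ℕ :=
  Nat.card {p : (V ↪ V') × (E ↪ E') // ∀ e, G.ends (p.2 e) = (F.ends e).map p.1}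

/-- `t_inj(F, G) = inj(F, G) / (n)_k` with `k = |V(F)|`, `n = |V(G)|` and
`(n)_k = n (n - 1) ⋯ (n - k + 1)`. -/
noncomputable def Multigraph.tInj {V E V' E' : Type*} (F : Multigraph V E)
    (G : Multigraph V' E') : ℝ :=
  (F.inj G : ℝ) / ((Nat.card V').descFactorial (Nat.card V) : ℝ)

/-- The integrand of `t(F, W)`: the product over the edges `ij` of `F` (with multiplicity) of
`W (x i) (x j)`. -/
noncomputable def Multigraph.edgeProd {V E : Type*} [Fintype E] (F : Multigraph V E)
    (W : {W : ℝ → ℝ → ℝ // ∀ x y, W x y = W y x}) (x : V → ℝ) : ℝ :=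
  ∏ e, Sym2.lift W ((F.ends e).map x)

/-- `t(F, W)`: the integral over the cube `[0,1]^V` of the product over the edges `ij` of `F` of
`W (x i) (x j)`, for a symmetric function `W` of two variables. -/
noncomputable def Multigraph.t {V E : Type*} [Fintype V] [Fintype E] (F : Multigraph V E)
    (W : {W : ℝ → ℝ → ℝ // ∀ x y, W x y = W y x}) : ℝ :=
  ∫ x in Set.Icc (0 : V → ℝ) 1, F.edgeProd W x

/-- The symmetric function `L_c(x, y) = c (ln x) (ln y)`. -/
noncomputable def logKernel (c : ℝ) : {W : ℝ → ℝ → ℝ // ∀ x y, W x y = W y x} :=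
  ⟨fun x y => c * Real.log x * Real.log y, fun _ _ => by ring⟩

/-- The law of the random sequence `v_1 … v_n v_{n+1} … v_{n+t}` of elements of an `n`-element
vertex set: it starts with the `n` vertices, and each of the `t` further elements is a copy of a
uniformly random entry of the current sequence. -/
noncomputable def attachmentSeq (n : ℕ) [NeZero n] : (t : ℕ) → PMF (Fin (n + t) → Fin n)
  | 0 => PMF.pure id
  | t + 1 => (attachmentSeq n t).bind fun s =>
      (PMF.uniformOfFintype (Fin (n + t))).map fun i =>
        (Fin.snoc (α := fun _ => Fin n) s (s i) : Fin (n + t + 1) → Fin n)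

/-- The multigraph whose `j`-th edge (`j = 0, …, m - 1`) joins the entries of the sequence at the
(zero-based) positions `n + 2 j` and `n + 2 j + 1`. -/
def graphOfSeq {n m : ℕ} (s : Fin (n + 2 * m) → Fin n) : Multigraph (Fin n) (Fin m) :=
  ⟨fun j => s(s ⟨n + 2 * j, by omega⟩, s ⟨n + 2 * j + 1, by omega⟩)⟩

/-- The law of the preferential attachment graph `PAG(n, m)` with `n` fixed nodes and `m` edges;
the edges are indexed in the order in which they arise. -/
noncomputable def PAG (n m : ℕ) [NeZero n] : PMF (Multigraph (Fin n) (Fin m)) :=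
  (attachmentSeq n (2 * m)).map graphOfSeq

/-! ### Exponential moments and the integral `t(F, L_c)` -/

/-! The kernel `L_c` has rank one, so the integrand of `t(F, L_c)` is `c ^ l` times a product of
powers of logarithms, one per vertex. The substitution `x = exp (-y)` turns each factor into a Gamma
integral, and the signs cancel by the handshake identity.

For the random graph, the attachment sequence is a Pólya urn. By de Finetti, its added entries are
independent draws from a random weight vector `p`, uniform on the simplex, realised here as
normalised independent exponentials (`sum_attachmentSeq_mul`, `toMeasure_PAG`). Given `p`, the edges
are independent, and one edge joins distinct `a`, `b` with probability `2 p_a p_b`. The conditional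
mean of `inj(F, ·)` is therefore `(m)_l 2^l ∑_φ ∏ p_{φ i}^{r_i}`. Power sums of exponentials obey a
law of large numbers with limits `r!`, and non-injective `φ` are negligible, so after division by
`(n)_k` this mean tends to `c ^ l ∏ r_i!` (`tendsto_normalized_sum`).

Only pairs of maps that share an edge contribute to the conditional variance, which is on average
`O(n ^ (2k - 2))` (`integral_sub_meanInj_sq_le`). Chebyshev for the graph and a fourth moment bound
for the power sums give summable deviation probabilities. Borel–Cantelli then applies whatever the
joint distribution, and there are countably many `F`. -/

theorem integrableOn_pow_mul_exp_neg (a : ℕ) {r : ℝ} (hr : 0 < r) :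
    IntegrableOn (fun x : ℝ => x ^ a * Real.exp (-(r * x))) (Set.Ioi 0) := by
  have h := integrableOn_rpow_mul_exp_neg_mul_rpow (p := 1) (s := a) (b := r)
    (by have : (0 : ℝ) ≤ a := Nat.cast_nonneg a
        linarith) one_pos hr
  simpa [Real.rpow_natCast, Real.rpow_one] using h

theorem integral_pow_mul_exp_neg (a : ℕ) {r : ℝ} (hr : 0 < r) :
    ∫ x in Set.Ioi (0 : ℝ), x ^ a * Real.exp (-(r * x)) = a.factorial / r ^ (a + 1) := by
  have h := Real.integral_rpow_mul_exp_neg_mul_Ioi (a := a + 1) (r := r) (by positivity) hr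
  rw [Real.Gamma_nat_eq_factorial] at h
  simp only [add_sub_cancel_right, Real.rpow_natCast] at h
  rw [h, ← Nat.cast_add_one, Real.rpow_natCast, one_div, inv_pow]
  ring

theorem image_exp_neg_Ioi : (fun x : ℝ => Real.exp (-x)) '' Set.Ioi 0 = Set.Ioo 0 1 := by
  ext y
  constructor
  · rintro ⟨x, hx, rfl⟩
    exact ⟨Real.exp_pos _, by simpa using hx⟩
  · rintro ⟨h0, h1⟩
    exact ⟨-Real.log y, by simpa using Real.log_neg h0 h1, by simp [Real.exp_log h0]⟩

theorem injOn_exp_neg (s : Set ℝ) : Set.InjOn (fun x : ℝ => Real.exp (-x)) s :=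
  fun x _ y _ h => by simpa using h

theorem hasDerivWithinAt_exp_neg (s : Set ℝ) (x : ℝ) :
    HasDerivWithinAt (fun x : ℝ => Real.exp (-x)) (-Real.exp (-x)) s x := by
  simpa using (hasDerivAt_neg x).exp.hasDerivWithinAt (s := s)

/-- Substituting `x = exp (-y)` leaves `(-1) ^ r * y ^ r * exp (-y)` on the half-line. -/
theorem integrable_log_pow (r : ℕ) :
    Integrable (fun x : ℝ => Real.log x ^ r) (volume.restrict (Set.Icc 0 1)) := by
  rw [restrict_Ioo_eq_restrict_Icc.symm, ← image_exp_neg_Ioi]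
  refine (integrableOn_image_iff_integrableOn_abs_deriv_smul measurableSet_Ioi
    (fun x _ => hasDerivWithinAt_exp_neg _ x) (injOn_exp_neg _) _).2 ?_
  have := (integrableOn_pow_mul_exp_neg r one_pos).const_mul ((-1) ^ r)
  refine this.congr (Eventually.of_forall fun x => ?_)
  simp only [abs_neg, abs_of_pos (Real.exp_pos _), Real.log_exp, smul_eq_mul, one_mul]
  rw [neg_pow x]; ring

theorem integral_log_pow_Icc (r : ℕ) :
    ∫ x in Set.Icc (0 : ℝ) 1, Real.log x ^ r = (-1) ^ r * r.factorial := by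
  rw [restrict_Ioo_eq_restrict_Icc.symm, ← image_exp_neg_Ioi,
    integral_image_eq_integral_abs_deriv_smul measurableSet_Ioi
    (fun x _ => hasDerivWithinAt_exp_neg _ x) (injOn_exp_neg _)]
  have h := integral_pow_mul_exp_neg r one_pos
  simp only [one_pow, div_one] at h
  rw [← h, ← integral_const_mul]
  congr 1 with x
  simp only [abs_neg, abs_of_pos (Real.exp_pos _), Real.log_exp, smul_eq_mul, one_mul]
  rw [neg_pow x]; ring

/-- Converts products over edge ends into products over vertices; a loop has multiplicity two, so it
fits the same formula. -/
theorem Sym2.prod_pow_count {V : Type*} [Fintype V] [DecidableEq V] (g : V → ℝ) (a b : V) :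
    ∏ v, g v ^ (s(a, b).toMultiset.count v) = g a * g b := by
  have h : ∀ v, g v ^ (s(a, b).toMultiset.count v) =
      (if v = a then g v else 1) * (if v = b then g v else 1) := by
    intro v
    have : s(a, b).toMultiset = a ::ₘ b ::ₘ 0 := rfl
    rw [this, Multiset.count_cons, Multiset.count_cons]
    rw [Multiset.count_zero, zero_add, pow_add, mul_comm]
    split_ifs <;> simp
  simp only [h, Finset.prod_mul_distrib]
  simp

theorem restrict_Icc_pi {V : Type*} [Fintype V] :
    (volume : Measure (V → ℝ)).restrict (Set.Icc 0 1) =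
      Measure.pi fun _ => (volume : Measure ℝ).restrict (Set.Icc 0 1) := by
  rw [← Measure.restrict_pi_pi]
  rw [← Set.pi_univ_Icc]; rfl

namespace Multigraph

variable {V E : Type*} [Fintype V] [DecidableEq V] [Fintype E]

theorem prod_pow_degree (F : Multigraph V E) (g : V → ℝ) :
    ∏ v, g v ^ F.degree v = ∏ e, ∏ v, g v ^ ((F.ends e).toMultiset.count v) := by
  rw [Finset.prod_comm]
  simp [degree, Finset.prod_pow_eq_pow_sum]

theorem edgeProd_logKernel (F : Multigraph V E) (c : ℝ) (x : V → ℝ) :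
    F.edgeProd (logKernel c) x = c ^ Fintype.card E * ∏ v, Real.log (x v) ^ F.degree v := by
  rw [F.prod_pow_degree fun v => Real.log (x v), edgeProd, ← Finset.card_univ,
    ← Finset.prod_const, ← Finset.prod_mul_distrib]
  refine Finset.prod_congr rfl fun e _ => ?_
  induction F.ends e with
  | h a b =>
    rw [Sym2.prod_pow_count fun v => Real.log (x v)]
    simp [logKernel, mul_assoc]

theorem sum_degree (F : Multigraph V E) : ∑ v, F.degree v = 2 * Fintype.card E := by
  simp only [degree]
  rw [Finset.sum_comm]
  have : ∀ e, ∑ v, (F.ends e).toMultiset.count v = 2 := by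
    intro e
    rw [Multiset.sum_count_eq_card (fun _ _ => Finset.mem_univ _)]
    exact Sym2.card_toMultiset _
  simp [this, mul_comm]

theorem integrableOn_edgeProd_logKernel (F : Multigraph V E) (c : ℝ) :
    IntegrableOn (F.edgeProd (logKernel c)) (Set.Icc 0 1) := by
  rw [IntegrableOn, restrict_Icc_pi]
  have := (Integrable.fintype_prod (μ := fun _ : V => (volume : Measure ℝ).restrict (Set.Icc 0 1))
    (f := fun v x => Real.log x ^ F.degree v) fun v => integrable_log_pow _).const_mul
    (c ^ Fintype.card E)
  exact this.congr (Eventually.of_forall fun x => (F.edgeProd_logKernel c x).symm)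

theorem t_logKernel (F : Multigraph V E) (c : ℝ) :
    F.t (logKernel c) = c ^ Fintype.card E * ∏ v, ((F.degree v).factorial : ℝ) := by
  rw [t, restrict_Icc_pi]
  simp only [edgeProd_logKernel]
  rw [integral_const_mul,
    integral_fintype_prod_eq_prod (f := fun (v : V) x => Real.log x ^ F.degree v)]
  -- The signs combine to `(-1)` raised to the degree sum, which is even.
  simp only [integral_log_pow_Icc, Finset.prod_mul_distrib, Finset.prod_pow_eq_pow_sum,
    F.sum_degree]
  simp

end Multigraph

/-! ### Normalised exponential variables -/

/-- The standard exponential law, with density `exp (-x)` on `(0, ∞)`. -/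
noncomputable def expLaw : Measure ℝ :=
  (volume.restrict (Set.Ioi 0)).withDensity fun x => ENNReal.ofReal (Real.exp (-x))

theorem ae_expLaw_pos : ∀ᵐ x ∂expLaw, 0 < x :=
  (withDensity_absolutelyContinuous _ _).ae_le (ae_restrict_mem measurableSet_Ioi)

theorem integrable_expLaw_iff (f : ℝ → ℝ) :
    Integrable f expLaw ↔ IntegrableOn (fun x => Real.exp (-x) * f x) (Set.Ioi 0) := by
  rw [expLaw, integrable_withDensity_iff_integrable_smul' (by fun_prop)
    (Eventually.of_forall fun _ => ENNReal.ofReal_lt_top)]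
  simp [IntegrableOn, ENNReal.toReal_ofReal (Real.exp_pos _).le]

theorem integral_expLaw (f : ℝ → ℝ) :
    ∫ x, f x ∂expLaw = ∫ x in Set.Ioi 0, Real.exp (-x) * f x := by
  rw [expLaw, integral_withDensity_eq_integral_toReal_smul (by fun_prop)
    (Eventually.of_forall fun _ => ENNReal.ofReal_lt_top)]
  simp [ENNReal.toReal_ofReal (Real.exp_pos _).le]

theorem exp_neg_mul_pow_mul_exp (a : ℕ) (t x : ℝ) :
    Real.exp (-x) * (x ^ a * Real.exp (-(t * x))) = x ^ a * Real.exp (-((1 + t) * x)) := by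
  rw [mul_left_comm, ← Real.exp_add]; ring_nf

theorem integrable_expLaw_pow_mul_exp (a : ℕ) {t : ℝ} (ht : 0 ≤ t) :
    Integrable (fun x => x ^ a * Real.exp (-(t * x))) expLaw := by
  rw [integrable_expLaw_iff]
  simp only [exp_neg_mul_pow_mul_exp]
  exact integrableOn_pow_mul_exp_neg a (by linarith)

theorem integral_expLaw_pow_mul_exp (a : ℕ) {t : ℝ} (ht : 0 ≤ t) :
    ∫ x, x ^ a * Real.exp (-(t * x)) ∂expLaw = a.factorial / (1 + t) ^ (a + 1) := by
  rw [integral_expLaw]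
  simp only [exp_neg_mul_pow_mul_exp]
  exact integral_pow_mul_exp_neg a (by linarith)

theorem integrable_expLaw_pow (a : ℕ) : Integrable (fun x => x ^ a) expLaw := by
  simpa using integrable_expLaw_pow_mul_exp a le_rfl

theorem integral_expLaw_pow (a : ℕ) : ∫ x, x ^ a ∂expLaw = a.factorial := by
  simpa using integral_expLaw_pow_mul_exp a le_rfl

instance : IsProbabilityMeasure expLaw := by
  have h1 := integrable_expLaw_pow 0
  have h2 := integral_expLaw_pow 0
  simp only [pow_zero, integrable_const_iff, one_ne_zero, false_or] at h1
  simp only [pow_zero, integral_const, Nat.factorial_zero, smul_eq_mul, mul_one, Nat.cast_one] at h2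
  refine ⟨?_⟩
  rwa [Measure.real, ENNReal.toReal_eq_one_iff] at h2

/-- The joint law of independent standard exponential variables indexed by `V`. -/
noncomputable def expPi (V : Type*) [Fintype V] : Measure (V → ℝ) := Measure.pi fun _ => expLaw

instance (V : Type*) [Fintype V] : IsProbabilityMeasure (expPi V) := by
  unfold expPi; infer_instance

/-- The coordinates of a vector divided by their sum. -/
noncomputable def normalized {V : Type*} [Fintype V] (x : V → ℝ) (v : V) : ℝ := x v / ∑ w, x w

/-! ### Moments of the uniform law on the simplex -/

section Dirichlet

variable {V : Type*} [Fintype V]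

theorem ae_expPi_pos : ∀ᵐ x ∂expPi V, ∀ v, 0 < x v :=
  ae_all_iff.2 fun v => (Measure.quasiMeasurePreserving_eval (fun _ : V => expLaw) v).ae ae_expLaw_pos

theorem measurable_normalized (v : V) : Measurable fun x : V → ℝ => normalized x v := by
  unfold normalized; fun_prop

theorem normalized_nonneg {x : V → ℝ} (hx : ∀ v, 0 < x v) (v : V) : 0 ≤ normalized x v :=
  div_nonneg (hx v).le (Finset.sum_nonneg fun w _ => (hx w).le)

theorem normalized_le_one {x : V → ℝ} (hx : ∀ v, 0 < x v) (v : V) : normalized x v ≤ 1 :=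
  div_le_one_of_le₀ (Finset.single_le_sum (fun w _ => (hx w).le) (Finset.mem_univ v))
    (Finset.sum_nonneg fun w _ => (hx w).le)

theorem sum_normalized [Nonempty V] {x : V → ℝ} (hx : ∀ v, 0 < x v) : ∑ v, normalized x v = 1 := by
  have : 0 < ∑ w, x w := Finset.sum_pos (fun w _ => hx w) Finset.univ_nonempty
  simp only [normalized, ← Finset.sum_div]
  exact div_self this.ne'

theorem integrable_prod_normalized {ι : Type*} (s : Finset ι) (f : ι → V) :
    Integrable (fun x => ∏ i ∈ s, normalized x (f i)) (expPi V) := by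
  refine Integrable.of_bound (C := 1)
    (Finset.measurable_fun_prod _ fun i _ => measurable_normalized (f i)).aestronglyMeasurable ?_
  filter_upwards [ae_expPi_pos] with x hx
  rw [Real.norm_of_nonneg (Finset.prod_nonneg fun i _ => normalized_nonneg hx _)]
  exact Finset.prod_le_one (fun i _ => normalized_nonneg hx _) fun i _ => normalized_le_one hx _

/-- The moments of the uniform law on the simplex. -/
noncomputable def dirichletMoment (a : V → ℕ) : ℝ :=
  ∫ x, ∏ v, normalized x v ^ a v ∂expPi V

theorem integrable_prod_normalized_pow (a : V → ℕ) :
    Integrable (fun x => ∏ v, normalized x v ^ a v) (expPi V) := by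
  refine Integrable.of_bound (C := 1) (Finset.measurable_fun_prod _ fun i _ =>
    (measurable_normalized i).pow_const _).aestronglyMeasurable ?_
  filter_upwards [ae_expPi_pos] with x hx
  rw [Real.norm_of_nonneg (Finset.prod_nonneg fun i _ => pow_nonneg (normalized_nonneg hx _) _)]
  exact Finset.prod_le_one (fun i _ => pow_nonneg (normalized_nonneg hx _) _)
    fun i _ => pow_le_one₀ (normalized_nonneg hx _) (normalized_le_one hx _)

/-- Read from right to left, this replaces a negative power of the coordinate sum `S` by a mixture
of `exp (-(S * t))`, which factors over the coordinates. -/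
theorem lintegral_pow_mul_exp_neg (A : ℕ) {S : ℝ} (hS : 0 < S) :
    ∫⁻ t in Set.Ioi (0 : ℝ), ENNReal.ofReal (t ^ A * Real.exp (-(S * t))) =
      ENNReal.ofReal (A.factorial / S ^ (A + 1)) := by
  rw [← integral_pow_mul_exp_neg A hS, ofReal_integral_eq_lintegral_ofReal
    (integrableOn_pow_mul_exp_neg A hS)]
  filter_upwards [ae_restrict_mem measurableSet_Ioi] with t ht
  have : (0 : ℝ) < t := ht
  positivity

theorem lintegral_expPi_prod (a : V → ℕ) {t : ℝ} (ht : 0 ≤ t) :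
    ∫⁻ x, ENNReal.ofReal (∏ v, x v ^ a v * Real.exp (-(t * x v))) ∂expPi V =
      ENNReal.ofReal (∏ v, ((a v).factorial / (1 + t) ^ (a v + 1) : ℝ)) := by
  simp only [← integral_expLaw_pow_mul_exp _ ht]
  rw [← integral_fintype_prod_eq_prod (μ := fun _ : V => expLaw)
      (f := fun v (y : ℝ) => y ^ a v * Real.exp (-(t * y))),
    ofReal_integral_eq_lintegral_ofReal]
  · rfl
  · exact Integrable.fintype_prod (f := fun v (y : ℝ) => y ^ a v * Real.exp (-(t * y)))
      fun v => integrable_expLaw_pow_mul_exp _ ht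
  · filter_upwards [ae_expPi_pos] with x hx
    exact Finset.prod_nonneg fun v _ => mul_nonneg (pow_nonneg (hx v).le _) (Real.exp_pos _).le

/-- Gamma function trick: the moment of order `a` is `∏ v, (a v)!` times a factor that depends only
on `∑ v, a v`. -/
theorem dirichletMoment_mul_factorial [Nonempty V] (a : V → ℕ) (A : ℕ) (hA : ∑ v, a v = A + 1) :
    ENNReal.ofReal (dirichletMoment a) * ENNReal.ofReal A.factorial =
      ENNReal.ofReal (∏ v, ((a v).factorial : ℝ)) * ∫⁻ t in Set.Ioi (0 : ℝ),
        ENNReal.ofReal (t ^ A / (1 + t) ^ (A + 1 + Fintype.card V)) := by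
  have h1 : ENNReal.ofReal (dirichletMoment a) * ENNReal.ofReal A.factorial =
      ∫⁻ x, (∫⁻ t in Set.Ioi (0 : ℝ), ENNReal.ofReal (t ^ A) *
        ENNReal.ofReal (∏ v, x v ^ a v * Real.exp (-(t * x v)))) ∂expPi V := by
    rw [dirichletMoment, ofReal_integral_eq_lintegral_ofReal (integrable_prod_normalized_pow a)
      (by filter_upwards [ae_expPi_pos] with x hx using
        Finset.prod_nonneg fun i _ => pow_nonneg (normalized_nonneg hx _) _),
      ← lintegral_mul_const' _ _ ENNReal.ofReal_ne_top]
    refine lintegral_congr_ae ?_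
    filter_upwards [ae_expPi_pos] with x hx
    have hS : 0 < ∑ w, x w := Finset.sum_pos (fun w _ => hx w) Finset.univ_nonempty
    have h2 : ∀ t, 0 < t → ENNReal.ofReal (t ^ A) *
        ENNReal.ofReal (∏ v, x v ^ a v * Real.exp (-(t * x v))) =
        ENNReal.ofReal (∏ v, x v ^ a v) *
          ENNReal.ofReal (t ^ A * Real.exp (-((∑ w, x w) * t))) := by
      intro t ht
      rw [← ENNReal.ofReal_mul (by positivity), ← ENNReal.ofReal_mul
        (Finset.prod_nonneg fun i _ => pow_nonneg (hx i).le _), Finset.prod_mul_distrib,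
        ← Real.exp_sum, Finset.sum_neg_distrib, ← Finset.mul_sum, mul_comm t]
      congr 1; ring
    rw [setLIntegral_congr_fun measurableSet_Ioi (fun t ht => h2 t ht),
      lintegral_const_mul' _ _ ENNReal.ofReal_ne_top, lintegral_pow_mul_exp_neg A hS,
      ← ENNReal.ofReal_mul (Finset.prod_nonneg fun i _ => pow_nonneg (hx i).le _),
      ← ENNReal.ofReal_mul (Finset.prod_nonneg fun i _ => pow_nonneg (normalized_nonneg hx _) _)]
    congr 1
    simp only [normalized, div_pow, Finset.prod_div_distrib, Finset.prod_pow_eq_pow_sum, hA]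
    ring
  -- Tonelli: for fixed `t` the inner integral factors into one-dimensional Gamma integrals. Working
  -- in `ENNReal` avoids integrability on the product.
  rw [h1, lintegral_lintegral_swap, ← lintegral_const_mul' _ _ ENNReal.ofReal_ne_top]
  · refine setLIntegral_congr_fun measurableSet_Ioi fun t ht => ?_
    have ht : 0 < t := ht
    rw [lintegral_const_mul' _ _ ENNReal.ofReal_ne_top, lintegral_expPi_prod a ht.le,
      ← ENNReal.ofReal_mul (by positivity), ← ENNReal.ofReal_mul (by positivity)]
    congr 1
    rw [Finset.prod_div_distrib, Finset.prod_pow_eq_pow_sum, Finset.sum_add_distrib, hA]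
    simp only [Finset.sum_const, Finset.card_univ, smul_eq_mul, mul_one]
    ring
  · refine Measurable.aemeasurable ?_
    simp only [Function.uncurry_def]
    refine (by fun_prop : Measurable fun z : (V → ℝ) × ℝ => ENNReal.ofReal (z.2 ^ A)).mul ?_
    refine ENNReal.measurable_ofReal.comp ?_
    fun_prop

/-- The `t`-integral in the Gamma trick depends only on the total order, so it is common to both
sides and need not be evaluated. -/
theorem dirichletMoment_mul_prod_factorial [Nonempty V] {a b : V → ℕ} {A : ℕ}
    (ha : ∑ v, a v = A + 1) (hb : ∑ v, b v = A + 1) :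
    dirichletMoment a * ∏ v, ((b v).factorial : ℝ) =
      dirichletMoment b * ∏ v, ((a v).factorial : ℝ) := by
  have h0 : ∀ c : V → ℕ, 0 ≤ dirichletMoment c := fun c => integral_nonneg_of_ae <| by
    filter_upwards [ae_expPi_pos] with x hx using
      Finset.prod_nonneg fun i _ => pow_nonneg (normalized_nonneg hx _) _
  have h1 := dirichletMoment_mul_factorial a A ha
  have h2 := dirichletMoment_mul_factorial b A hb
  have hc : ENNReal.ofReal A.factorial ≠ 0 := by
    simpa using A.factorial_ne_zero
  rw [← ENNReal.ofReal_eq_ofReal_iff (mul_nonneg (h0 _) (by positivity))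
    (mul_nonneg (h0 _) (by positivity)), ENNReal.ofReal_mul (h0 _), ENNReal.ofReal_mul (h0 _),
    ← ENNReal.mul_left_inj hc ENNReal.ofReal_ne_top, mul_right_comm, h1,
    mul_right_comm (ENNReal.ofReal (dirichletMoment b)), h2]
  ring

variable [DecidableEq V]

theorem prod_pow_add_single (g : V → ℝ) (a : V → ℕ) (w : V) :
    ∏ v, g v ^ (a + Pi.single w 1 : V → ℕ) v = g w * ∏ v, g v ^ a v := by
  simp only [Pi.add_apply, pow_add, Finset.prod_mul_distrib]
  rw [mul_comm]
  congr 1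
  rw [Finset.prod_eq_single w] <;> simp +contextual

theorem prod_factorial_add_single (a : V → ℕ) (w : V) :
    ∏ v, (((a + Pi.single w 1 : V → ℕ) v).factorial : ℝ) = (a w + 1) * ∏ v, ((a v).factorial : ℝ) := by
  rw [← Finset.mul_prod_erase _ _ (Finset.mem_univ w),
    ← Finset.mul_prod_erase _ (fun v => ((a v).factorial : ℝ)) (Finset.mem_univ w), ← mul_assoc]
  congr 1
  · simp [Nat.factorial_succ]
  · refine Finset.prod_congr rfl fun v hv => ?_
    simp [Pi.single_eq_of_ne (Finset.ne_of_mem_erase hv)]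

/-- Ratios of moments of equal order are known; since the normalised coordinates sum to one, the
moments of order one higher add up to the given moment, which fixes the constant. -/
theorem dirichletMoment_add_single [Nonempty V] (a : V → ℕ) (w : V) :
    dirichletMoment (a + Pi.single w 1) =
      (a w + 1) / (Fintype.card V + ∑ v, a v : ℕ) * dirichletMoment a := by
  have hsum : ∀ w, ∑ v, (a + Pi.single w 1 : V → ℕ) v = ∑ v, a v + 1 := fun w => by
    simp [Finset.sum_add_distrib]
  have hP : (∏ v, ((a v).factorial : ℝ)) ≠ 0 := by positivity
  have key : ∀ v, dirichletMoment (a + Pi.single v 1) * (a w + 1) =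
      dirichletMoment (a + Pi.single w 1) * (a v + 1) := by
    intro v
    have h := dirichletMoment_mul_prod_factorial (hsum v) (hsum w)
    rw [prod_factorial_add_single, prod_factorial_add_single, ← mul_assoc, ← mul_assoc] at h
    exact mul_right_cancel₀ hP h
  have hs : ∑ v, dirichletMoment (a + Pi.single v 1) = dirichletMoment a := by
    simp only [dirichletMoment]
    rw [← integral_finsetSum _ fun v _ => integrable_prod_normalized_pow _]
    refine integral_congr_ae ?_
    filter_upwards [ae_expPi_pos] with x hx
    simp only [prod_pow_add_single, ← Finset.sum_mul]
    rw [sum_normalized hx, one_mul]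
  have h2 : dirichletMoment a * (a w + 1) =
      dirichletMoment (a + Pi.single w 1) * (Fintype.card V + ∑ v, a v : ℕ) := by
    rw [← hs, Finset.sum_mul, Finset.sum_congr rfl fun v _ => key v, ← Finset.mul_sum]
    congr 1
    simp [Finset.sum_add_distrib, add_comm]
  have hn : ((Fintype.card V + ∑ v, a v : ℕ) : ℝ) ≠ 0 := by
    have := Fintype.card_pos (α := V)
    positivity
  rw [div_mul_eq_mul_div, eq_div_iff hn, ← h2, mul_comm]

theorem integral_prod_normalized_eq {ι : Type*} (s : Finset ι) (f : ι → V) :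
    ∫ x, ∏ i ∈ s, normalized x (f i) ∂expPi V =
      dirichletMoment fun v => (s.filter fun i => f i = v).card := by
  unfold dirichletMoment
  congr 1 with x
  rw [← Finset.prod_fiberwise' s f fun v => normalized x v]
  simp

/-- The urn recursion for the moments of the normalised exponential variables. -/
theorem integral_normalized_mul_prod [Nonempty V] {ι : Type*} (s : Finset ι) (f : ι → V) (w : V) :
    ∫ x, normalized x w * ∏ i ∈ s, normalized x (f i) ∂expPi V =
      ((s.filter fun i => f i = w).card + 1) / (Fintype.card V + s.card : ℕ) *
        ∫ x, ∏ i ∈ s, normalized x (f i) ∂expPi V := by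
  have h := dirichletMoment_add_single (fun v => (s.filter fun i => f i = v).card) w
  rw [Finset.sum_card_fiberwise_eq_card_filter] at h
  simp only [Finset.mem_univ, Finset.filter_true] at h
  rw [integral_prod_normalized_eq, ← h]
  unfold dirichletMoment
  congr 1 with x
  rw [prod_pow_add_single, ← Finset.prod_fiberwise' s f fun v => normalized x v]
  simp

/-- Each step of the urn recursion contributes a factor at most `(s.card + 1) / n`, with `n` the
number of vertices, however often the indices in `f` coincide. -/
theorem integral_prod_normalized_le [Nonempty V] {ι : Type*} (s : Finset ι) (f : ι → V) :
    ∫ x, ∏ i ∈ s, normalized x (f i) ∂expPi V ≤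
      (s.card.factorial : ℝ) / (Fintype.card V : ℝ) ^ s.card := by
  classical
  have hV : (0 : ℝ) < Fintype.card V := by exact_mod_cast Fintype.card_pos
  induction s using Finset.induction_on with
  | empty => simp
  | insert i s hi ih =>
    simp only [Finset.prod_insert hi, Finset.card_insert_of_notMem hi]
    rw [integral_normalized_mul_prod, Nat.factorial_succ, pow_succ']
    push_cast
    rw [mul_div_mul_comm]
    have hc : ((s.filter fun j => f j = f i).card : ℝ) ≤ s.card := by
      exact_mod_cast Finset.card_filter_le _ _
    have h0 : (0:ℝ) ≤ s.card := Nat.cast_nonneg _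
    refine mul_le_mul ?_ ih ?_ (by positivity)
    · exact div_le_div₀ (by positivity) (by linarith) hV (by linarith)
    · refine integral_nonneg_of_ae ?_
      filter_upwards [ae_expPi_pos] with x hx using
        Finset.prod_nonneg fun i _ => normalized_nonneg hx _

end Dirichlet

/-! ### The law of the preferential attachment graph as a mixture -/

theorem PMF.sum_bind_mul {α β : Type*} [Fintype α] [Fintype β] (p : PMF α) (g : α → PMF β)
    (f : β → ENNReal) : ∑ b, p.bind g b * f b = ∑ a, p a * ∑ b, g a b * f b := by
  simp only [PMF.bind_apply, tsum_fintype, Finset.sum_mul, Finset.mul_sum]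
  rw [Finset.sum_comm]
  simp only [mul_assoc]

theorem PMF.sum_map_mul {α β : Type*} [Fintype α] [Fintype β] (p : PMF α) (g : α → β)
    (f : β → ENNReal) : ∑ b, p.map g b * f b = ∑ a, p a * f (g a) := by
  classical
  rw [PMF.map, PMF.sum_bind_mul]
  simp [PMF.pure_apply]

/-- The new factor is the attachment probability of `v`: its copies among the added entries, plus
its one initial entry, over the current length. -/
theorem integral_prod_normalized_snoc {n : ℕ} [NeZero n] {t : ℕ} (u : Fin t → Fin n) (v : Fin n) :
    ENNReal.ofReal (∫ x, ∏ j, normalized x (Fin.snoc (α := fun _ => Fin n) u v j) ∂expPi (Fin n)) =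
      ENNReal.ofReal (∫ x, ∏ j, normalized x (u j) ∂expPi (Fin n)) *
        ((((Finset.univ.filter fun j => u j = v).card : ENNReal) + 1) * ((n + t : ℕ) : ENNReal)⁻¹) := by
  have hpos : (0 : ℝ) < (n + t : ℕ) := by
    have := NeZero.pos n
    positivity
  simp only [Fin.prod_univ_castSucc, Fin.snoc_castSucc, Fin.snoc_last]
  simp only [mul_comm _ (normalized _ v)]
  rw [integral_normalized_mul_prod, mul_comm, ENNReal.ofReal_mul' (by positivity)]
  congr 1
  simp only [Fintype.card_fin, Finset.card_univ]
  rw [div_eq_mul_inv, ENNReal.ofReal_mul (by positivity), ENNReal.ofReal_inv_of_pos hpos,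
    ENNReal.ofReal_natCast, ENNReal.ofReal_add (by positivity) (by positivity),
    ENNReal.ofReal_natCast, ENNReal.ofReal_one]

/-- The probability of the added entries `u` is a simplex moment, because both obey the same
one-step recursion. The first `n` entries are deterministic, hence `Fin.append id u`. -/
theorem sum_attachmentSeq_mul (n : ℕ) [NeZero n] (t : ℕ) (f : (Fin (n + t) → Fin n) → ENNReal) :
    ∑ s, attachmentSeq n t s * f s = ∑ u : Fin t → Fin n,
      ENNReal.ofReal (∫ x, ∏ j, normalized x (u j) ∂expPi (Fin n)) * f (Fin.append id u) := by
  classical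
  induction t with
  | zero =>
    have h : ∀ u : Fin 0 → Fin n, f (Fin.append id u) = f id := fun u => congrArg f <| by
      rw [Subsingleton.elim u Fin.elim0, Fin.append_elim0]; rfl
    trans f id
    · simp [attachmentSeq, PMF.pure_apply]
    · simp only [h]
      simp
  | succ t ih =>
    have : NeZero (n + t) := ⟨by have := NeZero.pos n; omega⟩
    rw [attachmentSeq, PMF.sum_bind_mul]
    simp only [PMF.sum_map_mul]
    rw [ih]
    rw [← (Fin.snocEquiv fun _ => Fin n).sum_comp, Fintype.sum_prod_type, Finset.sum_comm]
    refine Finset.sum_congr rfl fun u _ => ?_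
    simp only [Fin.snocEquiv, Equiv.coe_fn_mk, integral_prod_normalized_snoc, Fin.append_snoc]
    simp only [mul_assoc, ← Finset.mul_sum]
    congr 1
    simp only [PMF.uniformOfFintype_apply, Fintype.card_fin, ← Finset.mul_sum]
    -- The copied position is one of the `n` initial entries, each vertex occurring once, or one of
    -- the `t` added ones, grouped by vertex below.
    rw [Fin.sum_univ_add]
    simp only [Fin.append_left, Fin.append_right, id]
    simp only [add_mul, one_mul, Finset.sum_add_distrib, mul_add, ← Finset.mul_sum]
    rw [add_comm]
    congr 1
    simp only [mul_left_comm _ ((n + t : ℕ) : ENNReal)⁻¹, ← Finset.mul_sum]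
    congr 1
    rw [← Finset.sum_fiberwise' Finset.univ u fun v =>
      f (Fin.snoc (α := fun _ => Fin n) (Fin.append id u) v)]
    simp only [Finset.sum_const, nsmul_eq_mul]

/-- The edge-labelled multigraph with edges `u 0 u 1, u 2 u 3, …`. -/
def pairGraph {n m : ℕ} (u : Fin (2 * m) → Fin n) : Multigraph (Fin n) (Fin m) :=
  ⟨fun j => s(u ⟨2 * j, by omega⟩, u ⟨2 * j + 1, by omega⟩)⟩

theorem graphOfSeq_append {n m : ℕ} (u : Fin (2 * m) → Fin n) :
    graphOfSeq (Fin.append id u) = pairGraph u := by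
  have h : ∀ (i : ℕ) (hi : i < 2 * m) (hi' : n + i < n + 2 * m),
      Fin.append (id : Fin n → Fin n) u ⟨n + i, hi'⟩ = u ⟨i, hi⟩ := fun i hi hi' =>
    Fin.append_right id u ⟨i, hi⟩
  ext j : 2
  exact congrArg₂ (fun a b => s(a, b)) (h _ _ _) (h (2 * j + 1) (by omega) (by omega))

/-- The indicator of a proposition. -/
noncomputable def propIndicator (p : Prop) : ℝ := by
  classical exact if p then 1 else 0

theorem propIndicator_eq_ite (p : Prop) [Decidable p] :
    propIndicator p = if p then 1 else 0 := by
  unfold propIndicator; congr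

theorem propIndicator_of_true {p : Prop} (h : p) : propIndicator p = 1 := if_pos h

theorem propIndicator_of_false {p : Prop} (h : ¬ p) : propIndicator p = 0 := if_neg h

theorem propIndicator_nonneg (p : Prop) : 0 ≤ propIndicator p := by
  by_cases h : p
  · rw [propIndicator_of_true h]; exact zero_le_one
  · rw [propIndicator_of_false h]

theorem propIndicator_mono {p q : Prop} (h : p → q) : propIndicator p ≤ propIndicator q := by
  by_cases hp : p
  · rw [propIndicator_of_true hp, propIndicator_of_true (h hp)]
  · rw [propIndicator_of_false hp]; exact propIndicator_nonneg q

theorem propIndicator_mul (p q : Prop) :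
    propIndicator p * propIndicator q = propIndicator (p ∧ q) := by
  by_cases hp : p
  · by_cases hq : q
    · rw [propIndicator_of_true hp, propIndicator_of_true hq, propIndicator_of_true ⟨hp, hq⟩, one_mul]
    · rw [propIndicator_of_false hq, propIndicator_of_false fun h : p ∧ q => hq h.2, mul_zero]
  · rw [propIndicator_of_false hp, propIndicator_of_false fun h : p ∧ q => hp h.1, zero_mul]

/-- Expectation over `m` edges whose ends are drawn independently with weights `p`. -/
noncomputable def pairExp {n m : ℕ} (p : Fin n → ℝ) (f : Multigraph (Fin n) (Fin m) → ℝ) : ℝ :=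
  ∑ u : Fin (2 * m) → Fin n, (∏ j, p (u j)) * f (pairGraph u)

theorem pairExp_nonneg {n m : ℕ} {p : Fin n → ℝ} (hp : ∀ v, 0 ≤ p v)
    {f : Multigraph (Fin n) (Fin m) → ℝ} (hf : ∀ g, 0 ≤ f g) : 0 ≤ pairExp p f :=
  Finset.sum_nonneg fun _ _ => mul_nonneg (Finset.prod_nonneg fun _ _ => hp _) (hf _)

theorem pairExp_mono {n m : ℕ} {p : Fin n → ℝ} (hp : ∀ v, 0 ≤ p v)
    {f f' : Multigraph (Fin n) (Fin m) → ℝ} (hf : ∀ g, f g ≤ f' g) : pairExp p f ≤ pairExp p f' :=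
  Finset.sum_le_sum fun _ _ => mul_le_mul_of_nonneg_left (hf _) (Finset.prod_nonneg fun _ _ => hp _)

theorem pairExp_sum {n m : ℕ} (p : Fin n → ℝ) {ι : Type*} (s : Finset ι)
    (f : ι → Multigraph (Fin n) (Fin m) → ℝ) :
    pairExp p (fun g => ∑ i ∈ s, f i g) = ∑ i ∈ s, pairExp p (f i) := by
  simp only [pairExp, Finset.mul_sum]
  exact Finset.sum_comm

theorem pairExp_add {n m : ℕ} (p : Fin n → ℝ) (f f' : Multigraph (Fin n) (Fin m) → ℝ) :
    pairExp p (fun g => f g + f' g) = pairExp p f + pairExp p f' := by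
  simp [pairExp, mul_add, Finset.sum_add_distrib]

theorem pairExp_const_mul {n m : ℕ} (p : Fin n → ℝ) (c : ℝ) (f : Multigraph (Fin n) (Fin m) → ℝ) :
    pairExp p (fun g => c * f g) = c * pairExp p f := by
  simp only [pairExp, Finset.mul_sum, mul_left_comm]

theorem integrable_pairExp {n m : ℕ} (f : Multigraph (Fin n) (Fin m) → ℝ) :
    Integrable (fun x => pairExp (normalized x) f) (expPi (Fin n)) :=
  integrable_finsetSum _ fun u _ => (integrable_prod_normalized Finset.univ u).mul_const _

/-- De Finetti representation of the law of `PAG(n, m)`. -/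
theorem toMeasure_PAG (n m : ℕ) [NeZero n] (B : Set (Multigraph (Fin n) (Fin m))) :
    (PAG n m).toMeasure B = ENNReal.ofReal
      (∫ x, pairExp (normalized x) (fun g => propIndicator (g ∈ B)) ∂expPi (Fin n)) := by
  classical
  have h1 : (PAG n m).toMeasure B =
      ∑ s, attachmentSeq n (2 * m) s * if graphOfSeq s ∈ B then 1 else 0 := by
    rw [PMF.toMeasure_apply_eq_toOuterMeasure_apply _ (by trivial), PAG,
      PMF.toOuterMeasure_map_apply, PMF.toOuterMeasure_apply, tsum_fintype]
    simp [Set.indicator]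
  rw [h1, sum_attachmentSeq_mul]
  simp only [pairExp, graphOfSeq_append]
  rw [integral_finsetSum _ fun u _ => (integrable_prod_normalized Finset.univ u).mul_const _,
    ENNReal.ofReal_sum_of_nonneg]
  · refine Finset.sum_congr rfl fun u _ => ?_
    rw [integral_mul_const]
    rw [propIndicator_eq_ite]
    split_ifs <;> simp
  · intro u _
    refine integral_nonneg_of_ae ?_
    filter_upwards [ae_expPi_pos] with x hx
    exact mul_nonneg (Finset.prod_nonneg fun i _ => normalized_nonneg hx _)
      (propIndicator_nonneg _)

/-! ### Fourth moments of sums of independent centred variables -/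

section FourthMoment

variable {Ω ι : Type*} [MeasurableSpace Ω] {P : Measure Ω}

theorem ProbabilityTheory.IndepFun.integrable_pow_mul_pow {X Y : Ω → ℝ} (h : IndepFun X Y P) {a b : ℕ}
    (hX : Integrable (fun ω => X ω ^ a) P) (hY : Integrable (fun ω => Y ω ^ b) P) :
    Integrable (fun ω => X ω ^ a * Y ω ^ b) P :=
  (h.comp (φ := fun x => x ^ a) (ψ := fun x => x ^ b) (by fun_prop) (by fun_prop)).integrable_mul
    hX hY

theorem ProbabilityTheory.IndepFun.integral_pow_mul_pow {X Y : Ω → ℝ} (h : IndepFun X Y P) {a b : ℕ}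
    (hX : Integrable (fun ω => X ω ^ a) P) (hY : Integrable (fun ω => Y ω ^ b) P) :
    ∫ ω, X ω ^ a * Y ω ^ b ∂P = (∫ ω, X ω ^ a ∂P) * ∫ ω, Y ω ^ b ∂P :=
  (h.comp (φ := fun x => x ^ a) (ψ := fun x => x ^ b) (by fun_prop)
    (by fun_prop)).integral_fun_mul_eq_mul_integral hX.aestronglyMeasurable hY.aestronglyMeasurable

theorem ProbabilityTheory.IndepFun.integrable_add_pow {X Y : Ω → ℝ} (h : IndepFun X Y P)
    (hX : ∀ a, Integrable (fun ω => X ω ^ a) P) (hY : ∀ a, Integrable (fun ω => Y ω ^ a) P)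
    (a : ℕ) : Integrable (fun ω => (X ω + Y ω) ^ a) P := by
  simp only [add_pow]
  exact integrable_finsetSum _ fun i _ => (h.integrable_pow_mul_pow (hX _) (hY _)).mul_const _

/-- When an independent centred variable is added, the terms of the fourth power containing a first
moment vanish, and `κ + 6 * s.card * σ ^ 2` is gained. Growth is thus quadratic. Here `σ` is the
variance; integrability of all powers is carried through the induction. -/
theorem ProbabilityTheory.iIndepFun.fourth_moment_sum [IsProbabilityMeasure P] {ξ : ι → Ω → ℝ} (h : iIndepFun ξ P)
    (hm : ∀ i, Measurable (ξ i)) (hint : ∀ i a, Integrable (fun ω => ξ i ω ^ a) P)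
    (h1 : ∀ i, ∫ ω, ξ i ω ∂P = 0) {σ κ : ℝ} (h2 : ∀ i, ∫ ω, ξ i ω ^ 2 ∂P = σ)
    (h4 : ∀ i, ∫ ω, ξ i ω ^ 4 ∂P = κ) (s : Finset ι) :
    (∀ a, Integrable (fun ω => (∑ i ∈ s, ξ i ω) ^ a) P) ∧ ∫ ω, ∑ i ∈ s, ξ i ω ∂P = 0 ∧
      ∫ ω, (∑ i ∈ s, ξ i ω) ^ 2 ∂P = s.card * σ ∧
      ∫ ω, (∑ i ∈ s, ξ i ω) ^ 4 ∂P = s.card * κ + 3 * s.card * (s.card - 1) * σ ^ 2 := by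
  classical
  induction s using Finset.induction_on with
  | empty => simp
  | insert i s hi ih =>
    obtain ⟨ia, i1, i2, i4⟩ := ih
    have hind : IndepFun (fun ω => ∑ j ∈ s, ξ j ω) (ξ i) P := by
      have := h.indepFun_finsetSum_of_notMem hm hi
      convert this using 1
      ext ω; simp
    have hξ := hint i
    have e : ∀ ω, ∑ j ∈ insert i s, ξ j ω = (∑ j ∈ s, ξ j ω) + ξ i ω := fun ω => by
      rw [Finset.sum_insert hi, add_comm]
    simp only [e, Finset.card_insert_of_notMem hi]
    have m : ∀ a b, Integrable (fun ω => (∑ j ∈ s, ξ j ω) ^ a * ξ i ω ^ b) P := fun a b =>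
      hind.integrable_pow_mul_pow (ia a) (hξ b)
    have v : ∀ a b, ∫ ω, (∑ j ∈ s, ξ j ω) ^ a * ξ i ω ^ b ∂P = _ := fun a b =>
      hind.integral_pow_mul_pow (ia a) (hξ b)
    have i1' : ∫ ω, (∑ i ∈ s, ξ i ω) ^ 1 ∂P = 0 := by simpa using i1
    have h1' : ∫ ω, ξ i ω ^ 1 ∂P = 0 := by simpa using h1 i
    have expand : ∀ a : ℕ, ∫ ω, ((∑ j ∈ s, ξ j ω) + ξ i ω) ^ a ∂P =
        ∑ b ∈ Finset.range (a + 1), (∫ ω, (∑ j ∈ s, ξ j ω) ^ b ∂P) *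
          (∫ ω, ξ i ω ^ (a - b) ∂P) * a.choose b := by
      intro a
      simp only [add_pow]
      rw [integral_finsetSum _ fun b _ => (m _ _).mul_const _]
      simp only [integral_mul_const, v]
    refine ⟨hind.integrable_add_pow ia hξ, ?_, ?_, ?_⟩
    · have := expand 1
      simpa [Finset.sum_range_succ, i1', h1', i1, h1 i] using this
    · rw [expand 2]
      simp [Finset.sum_range_succ, i1, h1 i, i2, h2 i]
      ring
    · rw [expand 4]
      simp [Finset.sum_range_succ, i1, h1 i, i2, h2 i, h4 i, i4,
        show Nat.choose 4 2 = 6 from rfl]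
      ring

end FourthMoment

/-! ### The filter of complete convergence -/

section CompleteConvergence

variable {Ω : ℕ → Type*} [∀ n, MeasurableSpace (Ω n)]

/-- The filter of complete convergence: `A` belongs to it if the probabilities of the complements
of the slices of `A` are summable. -/
def completeFilter (μ : ∀ n, Measure (Ω n)) : Filter (Σ n, Ω n) where
  sets := {A | ∑' n, μ n {x | (⟨n, x⟩ : Σ n, Ω n) ∉ A} ≠ ⊤}
  univ_sets := by simp
  sets_of_superset {A B} hA hAB :=
    ne_top_of_le_ne_top hA (ENNReal.tsum_le_tsum fun n => measure_mono fun _ hx h => hx (hAB h))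
  inter_sets {A B} hA hB := by
    refine ne_top_of_le_ne_top (ENNReal.add_ne_top.2 ⟨hA, hB⟩) ?_
    rw [← ENNReal.tsum_add]
    refine ENNReal.tsum_le_tsum fun n => (measure_mono fun x hx => ?_).trans (measure_union_le _ _)
    by_contra h
    simp only [Set.mem_union, Set.mem_ofPred_eq, not_or, not_not] at h
    exact hx h

variable (μ : ∀ n, Measure (Ω n))

theorem mem_completeFilter {A : Set (Σ n, Ω n)} : A ∈ completeFilter μ ↔
    ∑' n, μ n {x | (⟨n, x⟩ : Σ n, Ω n) ∉ A} ≠ ⊤ := Iff.rfl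

/-- Discarding finitely many `n` costs a finite sum of finite measures. -/
theorem tendsto_fst_completeFilter [∀ n, IsFiniteMeasure (μ n)] :
    Tendsto Sigma.fst (completeFilter μ) atTop := by
  refine tendsto_atTop.2 fun N => ?_
  rw [Filter.Eventually, mem_completeFilter]
  rw [tsum_eq_sum (s := Finset.range N)]
  · exact (ENNReal.sum_lt_top.2 fun n _ => measure_lt_top _ _).ne
  · intro n hn
    have : N ≤ n := by simpa using hn
    simp [this]

theorem eventually_completeFilter_of_ae {p : (Σ n, Ω n) → Prop}
    (h : ∀ n, ∀ᵐ x ∂μ n, p ⟨n, x⟩) : ∀ᶠ z in completeFilter μ, p z := by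
  rw [Filter.Eventually, mem_completeFilter]
  have : ∀ n, μ n {x | ¬ p ⟨n, x⟩} = 0 := fun n => h n
  simp [this]

/-- Markov's inequality for the fourth power bounds the `n`-th probability by `C / (ε ^ 4 * n ^ 2)`,
which is summable. -/
theorem tendsto_completeFilter_of_fourth_moment [∀ n, IsFiniteMeasure (μ n)]
    (f : ∀ n, Ω n → ℝ) (hf : ∀ n, Integrable (fun x => f n x ^ 4) (μ n)) {C : ℝ}
    (h : ∀ n, ∫ x, f n x ^ 4 ∂μ n ≤ C * (n : ℝ) ^ 2) :
    Tendsto (fun z : Σ n, Ω n => f z.1 z.2 / z.1) (completeFilter μ) (𝓝 0) := by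
  rw [Metric.tendsto_nhds]
  intro ε hε
  rw [Filter.Eventually, mem_completeFilter]
  have hs : Summable fun n : ℕ => C / ε ^ 4 * (1 / (n : ℝ) ^ 2) :=
    (Real.summable_one_div_nat_pow.2 one_lt_two).mul_left _
  refine ne_top_of_le_ne_top hs.tsum_ofReal_ne_top (ENNReal.tsum_le_tsum fun n => ?_)
  -- At `n = 0` division by zero gives `0`, so the exceptional slice is empty.
  rcases Nat.eq_zero_or_pos n with rfl | hn
  · simp [hε]
  have hn' : (0 : ℝ) < n := by exact_mod_cast hn
  have hset : {x | (⟨n, x⟩ : Σ n, Ω n) ∉ {z | dist (f z.1 z.2 / z.1) 0 < ε}} ⊆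
      {x | (ε * n) ^ 4 ≤ f n x ^ 4} := by
    intro x hx
    simp only [Set.mem_ofPred_eq, dist_zero_right, Real.norm_eq_abs, not_lt, abs_div,
      Nat.abs_cast, le_div_iff₀ hn'] at hx
    have := pow_le_pow_left₀ (by positivity) hx 4
    rwa [Even.pow_abs (by decide)] at this
  refine (measure_mono hset).trans ?_
  rw [← ofReal_measureReal]
  refine ENNReal.ofReal_le_ofReal ?_
  have h1 := mul_meas_ge_le_integral_of_nonneg (μ := μ n)
    (Eventually.of_forall fun x => (by positivity : 0 ≤ f n x ^ 4)) (hf n) ((ε * n) ^ 4)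
  have h2 := h1.trans (h n)
  rw [← le_div_iff₀' (by positivity)] at h2
  refine h2.trans (le_of_eq ?_)
  field_simp

end CompleteConvergence

/-- The filter of complete convergence for `n` independent exponential variables, `n → ∞`. -/
noncomputable def expFilter : Filter (Σ n : ℕ, (Fin n → ℝ)) :=
  completeFilter fun n => expPi (Fin n)

/-- A law of large numbers for the `r`-th powers, whose mean is `r!`, applied to the centred
variables `ξ`. -/
theorem tendsto_powerSum (r : ℕ) :
    Tendsto (fun z : Σ n : ℕ, (Fin n → ℝ) => (∑ v, z.2 v ^ r) / z.1) expFilter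
      (𝓝 r.factorial) := by
  have hint : ∀ a, Integrable (fun x : ℝ => (x ^ r - r.factorial) ^ a) expLaw := by
    intro a
    simp only [sub_eq_add_neg, add_pow, ← pow_mul]
    exact integrable_finsetSum _ fun i _ =>
      ((integrable_expLaw_pow _).mul_const _).mul_const _
  set ξ : ℝ → ℝ := fun x => x ^ r - r.factorial with hξ
  set σ := ∫ x, ξ x ^ 2 ∂expLaw
  set κ := ∫ x, ξ x ^ 4 ∂expLaw
  have hev : ∀ (n : ℕ) (v : Fin n), MeasurePreserving (Function.eval v) (expPi (Fin n)) expLaw :=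
    fun n v => measurePreserving_eval _ v
  have hcomp : ∀ (n : ℕ) (v : Fin n) (a : ℕ),
      ∫ x, ξ (x v) ^ a ∂expPi (Fin n) = ∫ y, ξ y ^ a ∂expLaw := by
    intro n v a
    have := integral_map (μ := expPi (Fin n)) (φ := Function.eval v)
      (hev n v).measurable.aemeasurable
      (f := fun y => ξ y ^ a) (by rw [(hev n v).map_eq]; exact (hint a).aestronglyMeasurable)
    rw [(hev n v).map_eq] at this
    exact this.symm
  have key : ∀ n : ℕ, _ := fun n =>
    iIndepFun.fourth_moment_sum (P := expPi (Fin n)) (ξ := fun v x => ξ (x v))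
      (iIndepFun_pi (X := fun _ => ξ) fun _ => by fun_prop) (fun v => by fun_prop)
      (fun v a => (hev n v).integrable_comp_of_integrable (hint a))
      (fun v => by
        have := hcomp n v 1
        simp only [pow_one] at this
        rw [this, hξ, integral_sub (integrable_expLaw_pow r) (integrable_const _),
          integral_expLaw_pow]
        simp)
      (fun v => hcomp n v 2) (fun v => hcomp n v 4) Finset.univ
  have h0 := tendsto_completeFilter_of_fourth_moment (fun n => expPi (Fin n))
    (fun n x => ∑ v, ξ (x v)) (fun n => (key n).1 4) (C := |κ| + 3 * σ ^ 2) (fun n => by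
      rw [(key n).2.2.2]
      simp only [Finset.card_univ, Fintype.card_fin]
      have h1 : (n : ℝ) ≤ (n : ℝ) ^ 2 := by
        exact_mod_cast Nat.le_self_pow two_ne_zero n
      change (n : ℝ) * κ + 3 * n * (n - 1) * σ ^ 2 ≤ _
      have hn : (0 : ℝ) ≤ n := Nat.cast_nonneg n
      have h2 : (n : ℝ) * κ ≤ (n : ℝ) ^ 2 * |κ| :=
        (mul_le_mul_of_nonneg_left (le_abs_self κ) hn).trans
          (mul_le_mul_of_nonneg_right h1 (abs_nonneg κ))
      nlinarith [mul_nonneg hn (sq_nonneg σ)])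
  have h1 := h0.add_const (r.factorial : ℝ)
  rw [zero_add] at h1
  refine h1.congr' ?_
  filter_upwards [(tendsto_fst_completeFilter fun n => expPi (Fin n)).eventually_ge_atTop 1]
    with z hz
  have hz' : (z.1 : ℝ) ≠ 0 := by positivity
  simp only [hξ, Finset.sum_sub_distrib, Finset.sum_const, Finset.card_univ, Fintype.card_fin,
    nsmul_eq_mul]
  field_simp
  ring

/-! ### The conditional mean of the homomorphism numbers -/

section Embeddings

variable {ι V : Type*} [Fintype ι] [DecidableEq ι] [Fintype V] [DecidableEq V]

theorem sum_embedding_eq {M : Type*} [AddCommMonoid M] (g : (ι → V) → M) :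
    ∑ φ : ι ↪ V, g φ = ∑ φ : ι → V with Function.Injective φ, g φ := by
  rw [← Finset.sum_subtype_eq_sum_filter, Finset.subtype_univ]
  exact ((Equiv.subtypeInjectiveEquivEmbedding ι V).sum_comp fun φ => g φ).symm

theorem sum_embedding_le_sum {g : (ι → V) → ℝ} (hg : ∀ f, 0 ≤ g f) :
    ∑ φ : ι ↪ V, g φ ≤ ∑ f, g f := by
  rw [sum_embedding_eq]
  exact Finset.sum_le_sum_of_subset_of_nonneg (Finset.filter_subset _ _) fun f _ _ => hg f

/-- Once the common value of `φ i` and `φ j` is fixed, the constraint acts coordinate by coordinate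
and the sum factors. -/
theorem sum_prod_collision (w : ι → V → ℝ) {i j : ι} (hij : i ≠ j) :
    ∑ φ : ι → V with φ i = φ j, ∏ u, w u (φ u) =
      (∑ v, w i v * w j v) * ∏ u ∈ ({i, j} : Finset ι)ᶜ, ∑ v, w u v := by
  have h : ∀ v, (∑ φ : ι → V, ∏ u, if u ∈ ({i, j} : Finset ι) then
      (if φ u = v then w u v else 0) else w u (φ u)) =
      w i v * w j v * ∏ u ∈ ({i, j} : Finset ι)ᶜ, ∑ v, w u v := by
    intro v
    rw [← Fintype.prod_sum (f := fun u y => if u ∈ ({i, j} : Finset ι) then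
      (if y = v then w u v else 0) else w u y), ← Finset.prod_mul_prod_compl ({i, j} : Finset ι)]
    congr 1
    · rw [Finset.prod_pair hij]
      simp
    · refine Finset.prod_congr rfl fun u hu => ?_
      simp only [Finset.mem_compl.1 hu, if_false]
  rw [Finset.sum_mul]
  simp only [← h]
  rw [Finset.sum_comm, Finset.sum_filter]
  refine Finset.sum_congr rfl fun φ _ => ?_
  have h2 : ∀ v, (∏ u, if u ∈ ({i, j} : Finset ι) then
      (if φ u = v then w u v else 0) else w u (φ u)) =
      if φ i = v then (if φ j = v then ∏ u, w u (φ u) else 0) else 0 := by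
    intro v
    split_ifs with h1 h2
    · refine Finset.prod_congr rfl fun u _ => ?_
      split_ifs with h3 h4
      · rw [h4]
      · rcases Finset.mem_insert.1 h3 with rfl | h5
        · exact absurd h1 h4
        · rw [Finset.mem_singleton.1 h5] at h4
          exact absurd h2 h4
      · rfl
    · exact Finset.prod_eq_zero (Finset.mem_univ j) (by simp [h2])
    · exact Finset.prod_eq_zero (Finset.mem_univ i) (by simp [h1])
  simp only [h2, Finset.sum_ite_eq, Finset.mem_univ, if_true]
  simp only [eq_comm]

theorem sum_embedding_prod_le {w : ι → V → ℝ} (hw : ∀ i v, 0 ≤ w i v) :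
    ∑ φ : ι ↪ V, ∏ i, w i (φ i) ≤ ∏ i, ∑ v, w i v := by
  rw [Fintype.prod_sum]
  exact sum_embedding_le_sum (g := fun φ => ∏ i, w i (φ i))
    fun φ => Finset.prod_nonneg fun _ _ => hw _ _

/-- Union bound: a non-injective map collides at some pair of distinct indices. -/
theorem prod_sum_le_sum_embedding_add {w : ι → V → ℝ} (hw : ∀ i v, 0 ≤ w i v) :
    ∏ i, ∑ v, w i v ≤ ∑ φ : ι ↪ V, ∏ i, w i (φ i) +
      ∑ q : ι × ι with q.1 ≠ q.2, (∑ v, w q.1 v * w q.2 v) *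
        ∏ u ∈ ({q.1, q.2} : Finset ι)ᶜ, ∑ v, w u v := by
  rw [sum_embedding_eq fun φ => ∏ i, w i (φ i), Fintype.prod_sum,
    ← Finset.sum_filter_add_sum_filter_not _ fun φ : ι → V => Function.Injective φ]
  gcongr
  have h : ∀ q ∈ (Finset.univ.filter fun q : ι × ι => q.1 ≠ q.2),
      (∑ v, w q.1 v * w q.2 v) * ∏ u ∈ ({q.1, q.2} : Finset ι)ᶜ, ∑ v, w u v =
      ∑ φ : ι → V with φ q.1 = φ q.2, ∏ u, w u (φ u) := fun q hq =>
    (sum_prod_collision w (Finset.mem_filter.1 hq).2).symm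
  rw [Finset.sum_congr rfl h]
  simp only [Finset.sum_filter (s := (Finset.univ : Finset (ι → V)))]
  rw [Finset.sum_comm]
  refine Finset.sum_le_sum fun φ _ => ?_
  have h0 : 0 ≤ ∏ u, w u (φ u) := Finset.prod_nonneg fun _ _ => hw _ _
  have hnn : ∀ q ∈ (Finset.univ.filter fun q : ι × ι => q.1 ≠ q.2),
      0 ≤ if φ q.1 = φ q.2 then ∏ u, w u (φ u) else 0 := fun q _ => by split_ifs <;> simp [h0]
  split_ifs with hi
  · exact Finset.sum_nonneg hnn
  · simp only [Function.Injective, not_forall] at hi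
    obtain ⟨i, j, hij, hne⟩ := hi
    refine le_trans ?_ (Finset.single_le_sum hnn (a := (i, j)) (by simpa using hne))
    simp [hij]

end Embeddings

/-- Squeeze between the full product of power sums and that product minus the collision terms. -/
theorem tendsto_sum_embedding_pow {ι : Type*} [Fintype ι] [DecidableEq ι] (r : ι → ℕ) :
    Tendsto (fun z : Σ n : ℕ, (Fin n → ℝ) =>
      (∑ φ : ι ↪ Fin z.1, ∏ i, z.2 (φ i) ^ r i) / (z.1 : ℝ) ^ Fintype.card ι) expFilter
      (𝓝 (∏ i, ((r i).factorial : ℝ))) := by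
  have hfst : Tendsto (fun z : Σ n : ℕ, (Fin n → ℝ) => (z.1 : ℝ)) expFilter atTop :=
    tendsto_natCast_atTop_atTop.comp (tendsto_fst_completeFilter _)
  have hup : Tendsto (fun z : Σ n : ℕ, (Fin n → ℝ) => ∏ i, (∑ v, z.2 v ^ r i) / z.1) expFilter
      (𝓝 (∏ i, ((r i).factorial : ℝ))) :=
    tendsto_finsetProd _ fun i _ => tendsto_powerSum (r i)
  -- A collision merges two power sums into one of order `r q.1 + r q.2`, losing a factor `n`.
  have herr : Tendsto (fun z : Σ n : ℕ, (Fin n → ℝ) => ∑ q : ι × ι with q.1 ≠ q.2,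
      (z.1 : ℝ)⁻¹ * ((∑ v, z.2 v ^ (r q.1 + r q.2)) / z.1 *
        ∏ u ∈ ({q.1, q.2} : Finset ι)ᶜ, (∑ v, z.2 v ^ r u) / z.1)) expFilter (𝓝 0) := by
    rw [← Finset.sum_const_zero (s := Finset.univ.filter fun q : ι × ι => q.1 ≠ q.2)]
    refine tendsto_finsetSum _ fun q _ => ?_
    rw [← zero_mul (((r q.1 + r q.2).factorial : ℝ) *
      ∏ u ∈ ({q.1, q.2} : Finset ι)ᶜ, ((r u).factorial : ℝ))]
    exact (tendsto_inv_atTop_zero.comp hfst).mul ((tendsto_powerSum _).mul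
      (tendsto_finsetProd _ fun u _ => tendsto_powerSum (r u)))
  have hlow := hup.sub herr
  rw [sub_zero] at hlow
  have hpos : ∀ᶠ z : Σ n : ℕ, (Fin n → ℝ) in expFilter, ∀ v, 0 < z.2 v :=
    eventually_completeFilter_of_ae _ fun n => ae_expPi_pos
  have hge := hfst.eventually_gt_atTop 0
  refine tendsto_of_tendsto_of_tendsto_of_le_of_le' hlow hup ?_ ?_
  · filter_upwards [hpos, hge] with z hz hn
    have h := prod_sum_le_sum_embedding_add (w := fun (i : ι) v => z.2 v ^ r i)
      fun i v => pow_nonneg (hz v).le _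
    rw [sub_le_iff_le_add, Finset.prod_div_distrib, Finset.prod_const, Finset.card_univ,
      div_le_iff₀ (by positivity), add_mul, div_mul_cancel₀ _ (by positivity)]
    refine h.trans (le_of_eq ?_)
    congr 1
    rw [Finset.sum_mul]
    refine Finset.sum_congr rfl fun q hq => ?_
    have hq' : q.1 ≠ q.2 := (Finset.mem_filter.1 hq).2
    have hcard : Fintype.card ι = (({q.1, q.2} : Finset ι)ᶜ).card + 2 := by
      rw [← Finset.card_pair hq', Finset.card_compl_add_card]
    rw [Finset.prod_div_distrib, Finset.prod_const, hcard, pow_add]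
    simp only [pow_add]
    field_simp
  · filter_upwards [hpos, hge] with z hz hn
    rw [Finset.prod_div_distrib, Finset.prod_const, Finset.card_univ]
    gcongr
    exact sum_embedding_prod_le (w := fun (i : ι) v => z.2 v ^ r i)
      fun i v => pow_nonneg (hz v).le _

/-! ### Falling factorials and the limit of the conditional mean -/

theorem tendsto_descFactorial_div_pow {a : ℕ → ℕ} {b : ℕ → ℝ} {L : ℝ}
    (hab : Tendsto (fun n => (a n : ℝ) / b n) atTop (𝓝 L)) (hb : Tendsto b atTop atTop) (l : ℕ) :
    Tendsto (fun n => ((a n).descFactorial l : ℝ) / b n ^ l) atTop (𝓝 (L ^ l)) := by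
  induction l with
  | zero => simp
  | succ l ih =>
    -- Truncated subtraction lies between `a n - l` in the reals and `a n`.
    have h : Tendsto (fun n => ((a n - l : ℕ) : ℝ) / b n) atTop (𝓝 L) := by
      have hl : Tendsto (fun n => (a n : ℝ) / b n - l / b n) atTop (𝓝 L) := by
        simpa using hab.sub (hb.const_div_atTop (l : ℝ))
      refine tendsto_of_tendsto_of_tendsto_of_le_of_le' hl hab ?_ ?_
      · filter_upwards [hb.eventually_gt_atTop 0] with n hn
        rw [← sub_div]
        gcongr
        rw [sub_le_iff_le_add]
        exact_mod_cast le_tsub_add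
      · filter_upwards [hb.eventually_gt_atTop 0] with n hn
        gcongr
        exact Nat.sub_le _ _
    have := h.mul ih
    rw [← pow_succ'] at this
    refine this.congr fun n => ?_
    rw [Nat.descFactorial_succ, pow_succ']
    push_cast
    rw [mul_div_mul_comm]

theorem tendsto_descFactorial_self (k : ℕ) :
    Tendsto (fun n : ℕ => (n.descFactorial k : ℝ) / (n : ℝ) ^ k) atTop (𝓝 1) := by
  have h : Tendsto (fun n : ℕ => (n : ℝ) / n) atTop (𝓝 1) :=
    tendsto_const_nhds.congr' <| by
      filter_upwards [eventually_ne_atTop 0] with n hn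
      rw [div_self (by exact_mod_cast hn)]
  simpa using tendsto_descFactorial_div_pow (a := fun n => n) h tendsto_natCast_atTop_atTop k

/-- Since the exponents sum to `2 * l`, normalisation divides by the `2 * l`-th power of the
coordinate sum, asymptotically `n ^ (2 * l)`; this balances `(m)_l`. -/
theorem tendsto_normalized_sum {c : ℝ} {m : ℕ → ℕ}
    (hm : Tendsto (fun n : ℕ => (m n : ℝ) / (n : ℝ) ^ 2) atTop (𝓝 (c / 2)))
    {k l : ℕ} {r : Fin k → ℕ} (hr : ∑ i, r i = 2 * l) :
    Tendsto (fun z : Σ n : ℕ, (Fin n → ℝ) => ((m z.1).descFactorial l * (2 ^ l *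
      ∑ φ : Fin k ↪ Fin z.1, ∏ i, normalized z.2 (φ i) ^ r i)) / (z.1.descFactorial k : ℝ))
      expFilter (𝓝 (c ^ l * ∏ i, ((r i).factorial : ℝ))) := by
  have hfst := tendsto_fst_completeFilter fun n => expPi (Fin n)
  have h1 := (tendsto_descFactorial_div_pow hm
    ((tendsto_pow_atTop two_ne_zero).comp tendsto_natCast_atTop_atTop) l).comp hfst
  have h2 := (tendsto_descFactorial_self k).comp hfst
  have h3 := tendsto_sum_embedding_pow r
  have h4 := (tendsto_powerSum 1).pow (2 * l)
  have h := (((h1.const_mul (2 ^ l)).mul h3).div h2 one_ne_zero).div h4 (by simp)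
  have hlim : (2 ^ l * (c / 2) ^ l * ∏ i, ((r i).factorial : ℝ)) / 1 /
      (Nat.factorial 1 : ℝ) ^ (2 * l) = c ^ l * ∏ i, ((r i).factorial : ℝ) := by
    rw [← mul_pow, mul_div_cancel₀ _ (two_ne_zero)]
    simp
  rw [← hlim]
  refine h.congr' ?_
  -- The bound `k + 1` makes both `n` and `(n)_k` nonzero.
  filter_upwards [hfst.eventually_ge_atTop (k + 1),
    eventually_completeFilter_of_ae _ (p := fun z : Σ n : ℕ, (Fin n → ℝ) => ∀ v, 0 < z.2 v)
      fun n => ae_expPi_pos (V := Fin n)] with z hn hz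
  have hn0 : (z.1 : ℝ) ≠ 0 := by
    have : 0 < z.1 := by omega
    positivity
  have hd : (z.1.descFactorial k : ℝ) ≠ 0 := by
    have := Nat.descFactorial_pos (n := z.1) (k := k) |>.2 (by omega)
    positivity
  have hne : Nonempty (Fin z.1) := ⟨⟨0, by omega⟩⟩
  have hS : (∑ v, z.2 v) ≠ 0 := (Finset.sum_pos (fun v _ => hz v) Finset.univ_nonempty).ne'
  have hU : ∑ φ : Fin k ↪ Fin z.1, ∏ i, normalized z.2 (φ i) ^ r i =
      (∑ φ : Fin k ↪ Fin z.1, ∏ i, z.2 (φ i) ^ r i) / (∑ v, z.2 v) ^ (2 * l) := by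
    simp only [normalized, div_pow, Finset.prod_div_distrib, Finset.prod_pow_eq_pow_sum, hr,
      Finset.sum_div]
  simp only [Pi.div_apply, Function.comp_apply, hU, pow_one, div_pow, ← pow_mul, Fintype.card_fin]
  field_simp

/-! ### Independent edges -/

section IndependentEdges

variable {n m : ℕ}

/-- A sequence of `2 m` entries as a sequence of `m` consecutive pairs. -/
def pairsEquiv (n m : ℕ) : (Fin (2 * m) → Fin n) ≃ (Fin m → Fin n × Fin n) :=
  ((Equiv.arrowCongr (finProdFinEquiv.trans (finCongr (mul_comm m 2))).symm (Equiv.refl _)).trans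
    (Equiv.curry _ _ _)).trans (Equiv.piCongrRight fun _ => finTwoArrowEquiv _)

theorem pairsEquiv_apply (u : Fin (2 * m) → Fin n) (j : Fin m) :
    pairsEquiv n m u j = (u ⟨2 * j, by omega⟩, u ⟨2 * j + 1, by omega⟩) := by
  simp [pairsEquiv, finProdFinEquiv, finTwoArrowEquiv, Function.curry, add_comm]

theorem prod_eq_prod_pairs (p : Fin n → ℝ) (u : Fin (2 * m) → Fin n) :
    ∏ i, p (u i) = ∏ j, p (pairsEquiv n m u j).1 * p (pairsEquiv n m u j).2 := by
  rw [← (finProdFinEquiv.trans (finCongr (mul_comm m 2))).prod_comp, Fintype.prod_prod_type]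
  simp [pairsEquiv, finTwoArrowEquiv, Function.curry]

theorem pairGraph_ends (u : Fin (2 * m) → Fin n) (j : Fin m) :
    (pairGraph u).ends j = s((pairsEquiv n m u j).1, (pairsEquiv n m u j).2) := by
  rw [pairsEquiv_apply]; rfl

/-- The probability that two independent vertices with weights `p` form the pair `z`. -/
noncomputable def pairWeight (p : Fin n → ℝ) (z : Sym2 (Fin n)) : ℝ :=
  ∑ q : Fin n × Fin n, if s(q.1, q.2) = z then p q.1 * p q.2 else 0

theorem pairWeight_nonneg {p : Fin n → ℝ} (hp : ∀ v, 0 ≤ p v) (z : Sym2 (Fin n)) :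
    0 ≤ pairWeight p z :=
  Finset.sum_nonneg fun q _ => by split_ifs <;> simp [mul_nonneg, hp]

theorem pairWeight_of_ne (p : Fin n → ℝ) {a b : Fin n} (h : a ≠ b) :
    pairWeight p s(a, b) = 2 * p a * p b := by
  have : (Finset.univ.filter fun q : Fin n × Fin n => s(q.1, q.2) = s(a, b)) =
      {(a, b), (b, a)} := by
    ext q; simp [Prod.ext_iff]
  rw [pairWeight, ← Finset.sum_filter, this, Finset.sum_pair (by simp [h])]
  ring

theorem pairWeight_le {p : Fin n → ℝ} (hp : ∀ v, 0 ≤ p v) (a b : Fin n) :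
    pairWeight p s(a, b) ≤ 2 * (p a * p b) := by
  by_cases h : a = b
  · subst h
    have : (Finset.univ.filter fun q : Fin n × Fin n => s(q.1, q.2) = s(a, a)) = {(a, a)} := by
      ext q; simp [Prod.ext_iff]
    rw [pairWeight, ← Finset.sum_filter, this, Finset.sum_singleton]
    linarith [mul_nonneg (hp a) (hp a)]
  · rw [pairWeight_of_ne p h, mul_assoc]

/-- Distinct edge positions are independent, and an unconstrained position contributes `(∑ v, p v) ^
2 = 1`. -/
theorem pairExp_ends_eq {p : Fin n → ℝ} (hp : ∑ v, p v = 1) {A : Type*} (s : Finset A)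
    {Ψ : A → Fin m} (hΨ : Set.InjOn Ψ s) (y : A → Sym2 (Fin n)) :
    pairExp p (fun g => propIndicator (∀ a ∈ s, g.ends (Ψ a) = y a)) =
      ∏ a ∈ s, pairWeight p (y a) := by
  classical
  -- The indicator is spread over the positions `j`, so that the sum over all sequences becomes a
  -- product of sums.
  have h : ∀ u : Fin (2 * m) → Fin n, (∏ i, p (u i)) *
      propIndicator (∀ a ∈ s, (pairGraph u).ends (Ψ a) = y a) =
      ∏ j, if ∀ a ∈ s, Ψ a = j → s((pairsEquiv n m u j).1, (pairsEquiv n m u j).2) = y a then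
        p (pairsEquiv n m u j).1 * p (pairsEquiv n m u j).2 else 0 := by
    intro u
    rw [Finset.prod_ite_zero, prod_eq_prod_pairs, propIndicator_eq_ite, mul_ite, mul_one, mul_zero]
    simp only [pairGraph_ends]
    congr 1
    simp only [Finset.mem_univ, true_imp_iff, eq_iff_iff]
    exact ⟨fun h j a ha e => e ▸ h a ha, fun h a ha => h _ a ha rfl⟩
  simp only [pairExp, h]
  rw [(pairsEquiv n m).sum_comp fun w => ∏ j,
    if ∀ a ∈ s, Ψ a = j → s((w j).1, (w j).2) = y a then p (w j).1 * p (w j).2 else 0,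
    ← Fintype.prod_sum (f := fun j (q : Fin n × Fin n) =>
      if ∀ a ∈ s, Ψ a = j → s(q.1, q.2) = y a then p q.1 * p q.2 else 0),
    ← Finset.prod_fiberwise s Ψ]
  refine Finset.prod_congr rfl fun j _ => ?_
  by_cases hj : ∃ a ∈ s, Ψ a = j
  · obtain ⟨a, ha, rfl⟩ := hj
    have hf : s.filter (fun b => Ψ b = Ψ a) = {a} := by
      ext b
      simp only [Finset.mem_filter, Finset.mem_singleton]
      exact ⟨fun h => hΨ h.1 ha h.2, fun h => by subst h; exact ⟨ha, rfl⟩⟩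
    rw [hf, Finset.prod_singleton, pairWeight]
    refine Finset.sum_congr rfl fun q _ => ?_
    congr 1
    simp only [eq_iff_iff]
    exact ⟨fun h => h a ha rfl, fun h b hb e => hΨ hb ha e ▸ h⟩
  · have hf : s.filter (fun b => Ψ b = j) = ∅ :=
      Finset.filter_eq_empty_iff.2 fun b hb e => hj ⟨b, hb, e⟩
    rw [hf, Finset.prod_empty, Fintype.sum_prod_type, ← one_mul (1 : ℝ), ← hp,
      Finset.sum_mul_sum]
    refine Finset.sum_congr rfl fun a _ => Finset.sum_congr rfl fun b _ => if_pos ?_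
    exact fun b hb e => absurd ⟨b, hb, e⟩ hj

theorem pairExp_one {p : Fin n → ℝ} (hp : ∑ v, p v = 1) :
    pairExp p (fun _ : Multigraph (Fin n) (Fin m) => (1 : ℝ)) = 1 := by
  have := pairExp_ends_eq (m := m) hp (∅ : Finset Empty) (Ψ := Empty.elim) (by simp) Empty.elim
  simpa [propIndicator_of_true] using this

/-- Keeping one constraint per distinct position, each costs two weights, that is a factor of order
`n ^ (-2)`. Here `Ψ` may repeat positions and `y` may contain loops. -/
theorem integral_pairExp_ends_le [NeZero n] {A : Type*} (s : Finset A) (Ψ : A → Fin m)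
    (y : A → Sym2 (Fin n)) :
    ∫ x, pairExp (normalized x) (fun g => propIndicator (∀ a ∈ s, g.ends (Ψ a) = y a))
        ∂expPi (Fin n) ≤
      2 ^ s.card * (2 * s.card).factorial * (1 / (n : ℝ) ^ 2) ^ (s.image Ψ).card := by
  obtain ⟨t, hts, hinj, him⟩ :=
    Finset.exists_subset_injOn_image_eq_of_surjOn (f := Ψ) s (s.image Ψ) (by
      intro j hj; simpa using hj)
  have hcard : t.card = (s.image Ψ).card := by rw [← him, Finset.card_image_of_injOn hinj]
  have hle : t.card ≤ s.card := Finset.card_le_card hts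
  choose f f' hf using fun a => Sym2.exists.1 ⟨y a, rfl⟩
  have h1 : ∫ x, pairExp (normalized x)
      (fun g => propIndicator (∀ a ∈ s, g.ends (Ψ a) = y a)) ∂expPi (Fin n) ≤
      -- The two copies of `t` index the two ends of each retained edge.
      ∫ x, 2 ^ t.card * ∏ a ∈ t.disjSum t, normalized x (Sum.elim f f' a) ∂expPi (Fin n) := by
    refine integral_mono_ae (integrable_pairExp _) ((integrable_prod_normalized _ _).const_mul _) ?_
    filter_upwards [ae_expPi_pos] with x hx
    have hn := normalized_nonneg hx
    calc pairExp (normalized x) (fun g => propIndicator (∀ a ∈ s, g.ends (Ψ a) = y a))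
        ≤ pairExp (normalized x) (fun g => propIndicator (∀ a ∈ t, g.ends (Ψ a) = y a)) := by
          exact pairExp_mono hn fun g => propIndicator_mono fun h1 a ha => h1 a (hts ha)
      _ = ∏ a ∈ t, pairWeight (normalized x) (y a) := pairExp_ends_eq (sum_normalized hx) t hinj y
      _ ≤ ∏ a ∈ t, 2 * (normalized x (f a) * normalized x (f' a)) := by
          refine Finset.prod_le_prod (fun a _ => pairWeight_nonneg hn _) fun a _ => ?_
          rw [hf a]
          exact pairWeight_le hn _ _
      _ = 2 ^ t.card * ∏ a ∈ t.disjSum t, normalized x (Sum.elim f f' a) := by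
          rw [Finset.prod_mul_distrib, Finset.prod_const, Finset.prod_mul_distrib,
            Finset.prod_disjSum]
          rfl
  refine h1.trans ?_
  rw [integral_const_mul, mul_assoc]
  have h2 := integral_prod_normalized_le (t.disjSum t) (Sum.elim f f')
  rw [Finset.card_disjSum, ← two_mul, Fintype.card_fin] at h2
  refine mul_le_mul (pow_le_pow_right₀ one_le_two hle) (h2.trans ?_)
    (integral_nonneg_of_ae ?_) (by positivity)
  · rw [pow_mul, div_eq_mul_one_div, ← one_div_pow, ← hcard]
    gcongr
  · filter_upwards [ae_expPi_pos] with x hx using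
      Finset.prod_nonneg fun i _ => normalized_nonneg hx _

end IndependentEdges

/-! ### Counting maps by image size and by prescribed values -/

/-- Values are chosen one at a time: the next repeats one of at most `i` old values at no cost, or
is one of at most `m` new values at cost `x`. With `x = 1 / n ^ 2` and `m` of order `n ^ 2` the
bound stays bounded. -/
theorem sum_pow_card_image_le (m a : ℕ) {x : ℝ} (hx : 0 ≤ x) :
    ∑ Ψ : Fin a → Fin m, x ^ (Finset.univ.image Ψ).card ≤ (a + m * x) ^ a := by
  have key : ∑ Ψ : Fin a → Fin m, x ^ (Finset.univ.image Ψ).card ≤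
      ∏ i ∈ Finset.range a, (i + m * x) := by
    induction a with
    | zero => simp
    | succ a ih =>
      rw [← (Fin.consEquiv fun _ => Fin m).sum_comp, Fintype.sum_prod_type, Finset.sum_comm,
        Finset.prod_range_succ]
      refine le_trans ?_ (mul_le_mul_of_nonneg_right ih (by positivity))
      rw [Finset.sum_mul]
      refine Finset.sum_le_sum fun Ψ _ => ?_
      have him : ∀ v, Finset.univ.image (Fin.consEquiv (fun _ => Fin m) (v, Ψ)) =
          insert v (Finset.univ.image Ψ) := by
        intro v; ext w; simp [Fin.exists_fin_succ, Fin.consEquiv, eq_comm]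
      simp only [him]
      rw [← Finset.sum_add_sum_compl (Finset.univ.image Ψ), mul_add]
      refine add_le_add ?_ ?_
      · rw [Finset.sum_congr rfl fun v hv => by rw [Finset.insert_eq_of_mem hv], Finset.sum_const,
          nsmul_eq_mul, mul_comm]
        gcongr
        exact_mod_cast Finset.card_image_le.trans (by simp)
      · rw [Finset.sum_congr rfl fun v hv => by
          rw [Finset.card_insert_of_notMem (Finset.mem_compl.1 hv)], Finset.sum_const,
          nsmul_eq_mul, pow_succ, mul_left_comm]
        gcongr
        exact_mod_cast (Finset.card_le_univ _).trans (by simp)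
  refine key.trans ((Finset.prod_le_prod (fun i _ => by positivity) fun i hi => ?_).trans
    (by rw [Finset.prod_const, Finset.card_range]))
  have : (i : ℝ) ≤ a := by exact_mod_cast (Finset.mem_range.1 hi).le
  linarith

theorem card_two_values {k n : ℕ} {a b : Fin k} (hab : a ≠ b) (y y' : Fin n) :
    (Finset.univ.filter fun f : Fin k → Fin n => f a = y ∧ f b = y').card * n ^ 2 = n ^ k := by
  have h : (Finset.univ.filter fun f : Fin k → Fin n => f a = y ∧ f b = y') =
      Fintype.piFinset fun u => if u = a then {y} else if u = b then {y'} else Finset.univ := by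
    ext f
    simp only [Finset.mem_filter, Finset.mem_univ, true_and, Fintype.mem_piFinset]
    constructor
    · rintro ⟨h1, h2⟩ u
      split_ifs with h3 h4
      · simp [h3, h1]
      · simp [h4, h2]
      · simp
    · intro h
      have h1 := h a
      have h2 := h b
      simp only [if_true, if_neg hab.symm, Finset.mem_singleton] at h1 h2
      exact ⟨h1, h2⟩
  rw [h, Fintype.card_piFinset, ← Finset.prod_mul_prod_compl ({a, b} : Finset (Fin k)),
    Finset.prod_pair hab]
  have h2 : ∀ u ∈ ({a, b} : Finset (Fin k))ᶜ,
      (if u = a then {y} else if u = b then {y'} else Finset.univ : Finset (Fin n)).card = n := by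
    intro u hu
    simp only [Finset.mem_compl, Finset.mem_insert, Finset.mem_singleton, not_or] at hu
    simp [hu.1, hu.2]
  rw [Finset.prod_congr rfl h2, Finset.prod_const]
  simp only [if_true, if_neg hab.symm, Finset.card_singleton, one_mul]
  rw [← pow_add, ← Finset.card_pair hab, Finset.card_compl_add_card, Fintype.card_fin]

/-! ### The conditional variance of the homomorphism numbers -/

namespace Multigraph

variable {k l n m : ℕ}

/-- The pair of injective maps preserves incidence. -/
def Preserves (F : Multigraph (Fin k) (Fin l)) (G : Multigraph (Fin n) (Fin m))
    (q : (Fin k ↪ Fin n) × (Fin l ↪ Fin m)) : Prop :=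
  ∀ e, G.ends (q.2 e) = (F.ends e).map q.1

theorem inj_eq_sum (F : Multigraph (Fin k) (Fin l)) (G : Multigraph (Fin n) (Fin m)) :
    (F.inj G : ℝ) = ∑ q : (Fin k ↪ Fin n) × (Fin l ↪ Fin m), propIndicator (F.Preserves G q) := by
  classical
  rw [inj, Nat.card_eq_fintype_card, Fintype.card_subtype, Finset.card_filter]
  push_cast
  simp only [propIndicator_eq_ite, Preserves]

/-- Two maps form one system of `l + l` edge constraints, in which positions may repeat. -/
theorem preserves_mul_preserves (F : Multigraph (Fin k) (Fin l)) (G : Multigraph (Fin n) (Fin m))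
    (q q' : (Fin k ↪ Fin n) × (Fin l ↪ Fin m)) :
    propIndicator (F.Preserves G q) * propIndicator (F.Preserves G q') =
      propIndicator (∀ a ∈ (Finset.univ : Finset (Fin (l + l))), G.ends (Fin.append q.2 q'.2 a) =
        Fin.append (fun e => (F.ends e).map q.1) (fun e => (F.ends e).map q'.1) a) := by
  rw [propIndicator_mul]
  congr 1
  simp only [Finset.mem_univ, true_imp_iff, Fin.forall_fin_add, Fin.append_left, Fin.append_right,
    Preserves]

/-- The conditional probability, given the weights `p`, that a given pair of maps preserves
incidence. -/
noncomputable def mapWeight (F : Multigraph (Fin k) (Fin l)) (p : Fin n → ℝ)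
    (φ : Fin k ↪ Fin n) : ℝ :=
  2 ^ l * ∏ i, p (φ i) ^ F.degree i

/-- Looplessness and injectivity of `φ` keep the ends distinct, so every edge has exactly two orders
and gives a factor `2`. -/
theorem prod_pairWeight_eq {F : Multigraph (Fin k) (Fin l)} (hF : F.IsLoopless) (p : Fin n → ℝ)
    (φ : Fin k ↪ Fin n) : ∏ e, pairWeight p ((F.ends e).map φ) = F.mapWeight p φ := by
  rw [mapWeight, F.prod_pow_degree fun i => p (φ i)]
  have : (2 : ℝ) ^ l = ∏ _e : Fin l, 2 := by simp
  rw [this, ← Finset.prod_mul_distrib]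
  refine Finset.prod_congr rfl fun e _ => ?_
  have he := hF e
  induction hz : F.ends e with
  | h a b =>
    rw [hz, Sym2.mk_isDiag_iff] at he
    rw [Sym2.map_mk, pairWeight_of_ne p fun h => he (φ.injective h),
      Sym2.prod_pow_count fun i => p (φ i), mul_assoc]

theorem pairExp_preserves {F : Multigraph (Fin k) (Fin l)} (hF : F.IsLoopless) {p : Fin n → ℝ}
    (hp : ∑ v, p v = 1) (q : (Fin k ↪ Fin n) × (Fin l ↪ Fin m)) :
    pairExp p (fun G => propIndicator (F.Preserves G q)) = F.mapWeight p q.1 := by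
  rw [← prod_pairWeight_eq hF, ← pairExp_ends_eq hp Finset.univ (q.2.injective.injOn)]
  simp [Preserves]

theorem pairExp_preserves_mul_of_disjoint {F : Multigraph (Fin k) (Fin l)} (hF : F.IsLoopless)
    {p : Fin n → ℝ} (hp : ∑ v, p v = 1) {q q' : (Fin k ↪ Fin n) × (Fin l ↪ Fin m)}
    (hq : ∀ e e', q.2 e ≠ q'.2 e') :
    pairExp p (fun G => propIndicator (F.Preserves G q) * propIndicator (F.Preserves G q')) =
      F.mapWeight p q.1 * F.mapWeight p q'.1 := by
  simp only [preserves_mul_preserves]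
  have hinj : Function.Injective (Fin.append q.2 q'.2) :=
    Fin.append_injective_iff.2 ⟨q.2.injective, q'.2.injective, hq⟩
  rw [pairExp_ends_eq hp Finset.univ hinj.injOn, Fin.prod_univ_add]
  simp only [Fin.append_left, Fin.append_right, prod_pairWeight_eq hF]

/-- The conditional mean of `inj(F, ·)` given the weights `p`. -/
noncomputable def meanInj (F : Multigraph (Fin k) (Fin l)) (m : ℕ) (p : Fin n → ℝ) : ℝ :=
  m.descFactorial l * (2 ^ l * ∑ φ : Fin k ↪ Fin n, ∏ i, p (φ i) ^ F.degree i)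

theorem meanInj_eq_sum (F : Multigraph (Fin k) (Fin l)) (p : Fin n → ℝ) :
    F.meanInj m p = ∑ q : (Fin k ↪ Fin n) × (Fin l ↪ Fin m), F.mapWeight p q.1 := by
  rw [Fintype.sum_prod_type]
  simp only [Finset.sum_const, Finset.card_univ, Fintype.card_embedding_eq, Fintype.card_fin,
    nsmul_eq_mul, mapWeight, meanInj, Finset.mul_sum]

/-- Conditionally on the weights, only pairs of maps that share an edge contribute to the
variance. -/
theorem pairExp_sub_meanInj_sq_le {F : Multigraph (Fin k) (Fin l)} (hF : F.IsLoopless)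
    {p : Fin n → ℝ} (hp0 : ∀ v, 0 ≤ p v) (hp : ∑ v, p v = 1) :
    pairExp p (fun G : Multigraph (Fin n) (Fin m) => ((F.inj G : ℝ) - F.meanInj m p) ^ 2) ≤
      ∑ e, ∑ e', ∑ q : (Fin k ↪ Fin n) × (Fin l ↪ Fin m),
        ∑ q' : (Fin k ↪ Fin n) × (Fin l ↪ Fin m),
        if (F.ends e).map q.1 = (F.ends e').map q'.1 then
          pairExp p (fun G => propIndicator (F.Preserves G q) *
            propIndicator (F.Preserves G q')) else 0 := by
  set E : (Fin k ↪ Fin n) × (Fin l ↪ Fin m) → (Fin k ↪ Fin n) × (Fin l ↪ Fin m) → ℝ :=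
    fun q q' => pairExp p (fun G => propIndicator (F.Preserves G q) *
            propIndicator (F.Preserves G q')) with hE
  have hE0 : ∀ q q', 0 ≤ E q q' := fun q q' => pairExp_nonneg hp0 fun G => by
    exact mul_nonneg (propIndicator_nonneg _) (propIndicator_nonneg _)
  have hw : ∀ φ, 0 ≤ F.mapWeight p φ := fun φ =>
    mul_nonneg (by positivity) (Finset.prod_nonneg fun i _ => pow_nonneg (hp0 _) _)
  have hmean : pairExp p (fun G : Multigraph (Fin n) (Fin m) => (F.inj G : ℝ)) = F.meanInj m p := by
    simp only [inj_eq_sum]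
    rw [pairExp_sum, meanInj_eq_sum]
    exact Finset.sum_congr rfl fun q _ => pairExp_preserves hF hp q
  have hsq : pairExp p (fun G : Multigraph (Fin n) (Fin m) => (F.inj G : ℝ) ^ 2) =
      ∑ q, ∑ q', E q q' := by
    simp only [inj_eq_sum, pow_two, Finset.sum_mul_sum]
    simp only [pairExp_sum, hE]
  have hvar : pairExp p (fun G : Multigraph (Fin n) (Fin m) =>
      ((F.inj G : ℝ) - F.meanInj m p) ^ 2) = ∑ q, ∑ q', E q q' - F.meanInj m p ^ 2 := by
    have : ∀ G : Multigraph (Fin n) (Fin m), ((F.inj G : ℝ) - F.meanInj m p) ^ 2 =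
        (F.inj G : ℝ) ^ 2 + ((-2 * F.meanInj m p) * (F.inj G : ℝ) + F.meanInj m p ^ 2 * 1) :=
      fun G => by ring
    simp only [this]
    rw [pairExp_add, pairExp_add, pairExp_const_mul, pairExp_const_mul, hsq, hmean, pairExp_one hp]
    ring
  rw [hvar, meanInj_eq_sum, pow_two, Finset.sum_mul_sum]
  simp only [← Finset.sum_sub_distrib]
  have hswap : (∑ e, ∑ e', ∑ q : (Fin k ↪ Fin n) × (Fin l ↪ Fin m),
      ∑ q' : (Fin k ↪ Fin n) × (Fin l ↪ Fin m),
      if (F.ends e).map q.1 = (F.ends e').map q'.1 then E q q' else 0) =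
      ∑ q, ∑ q', ∑ e, ∑ e', if (F.ends e).map q.1 = (F.ends e').map q'.1 then E q q' else 0 := by
    simp only [Finset.sum_comm (s := (Finset.univ : Finset (Fin l)))
      (t := (Finset.univ : Finset ((Fin k ↪ Fin n) × (Fin l ↪ Fin m))))]
  rw [hswap]
  refine Finset.sum_le_sum fun q _ => Finset.sum_le_sum fun q' _ => ?_
  have hnn : ∀ e e', 0 ≤ if (F.ends e).map q.1 = (F.ends e').map q'.1 then E q q' else 0 :=
    fun e e' => by split_ifs <;> simp [hE0]
  -- Disjoint edge images have zero covariance. Otherwise the nonnegative product of means is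
  -- dropped, and the term of one shared edge on the right suffices.
  by_cases hq : ∀ e e', q.2 e ≠ q'.2 e'
  · have hEw : E q q' = F.mapWeight p q.1 * F.mapWeight p q'.1 :=
      pairExp_preserves_mul_of_disjoint hF hp hq
    have := Finset.sum_nonneg fun e (_ : e ∈ Finset.univ) =>
      Finset.sum_nonneg fun e' (_ : e' ∈ Finset.univ) => hnn e e'
    linarith
  · push Not at hq
    obtain ⟨e, e', hee⟩ := hq
    refine le_trans ?_ (Finset.single_le_sum (fun e _ => Finset.sum_nonneg fun e' _ => hnn e e')
      (Finset.mem_univ e))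
    refine le_trans ?_ (Finset.single_le_sum (fun e' _ => hnn e e') (Finset.mem_univ e'))
    have hww := mul_nonneg (hw q.1) (hw q'.1)
    split_ifs with hc
    · linarith
    -- The shared edge would need two different pairs of ends, so the two events exclude each other.
    · have : E q q' = 0 := by
        refine Finset.sum_eq_zero fun u _ => ?_
        simp only [propIndicator_mul]
        rw [propIndicator_of_false, mul_zero]
        rintro ⟨h1, h2⟩
        exact hc (by rw [← h1 e, ← h2 e', hee])
      linarith

/-- For fixed `φ`, the map `φ'` must send the two distinct ends of `e'` to a prescribed pair in one
of two orders, leaving at most `2 * n ^ (k - 2)` choices when `n` is positive. Multiplying by `n ^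
2` avoids subtraction in the exponent. -/
theorem sum_compatible_le {F : Multigraph (Fin k) (Fin l)} (hF : F.IsLoopless) (e e' : Fin l) :
    (n : ℝ) ^ 2 * ∑ φ : Fin k ↪ Fin n, ∑ φ' : Fin k ↪ Fin n,
      (if (F.ends e).map φ = (F.ends e').map φ' then 1 else 0) ≤ 2 * ((n : ℝ) ^ k) ^ 2 := by
  have h : ∀ φ : Fin k ↪ Fin n, (n : ℝ) ^ 2 * ∑ φ' : Fin k ↪ Fin n,
      (if (F.ends e).map φ = (F.ends e').map φ' then 1 else 0) ≤ 2 * (n : ℝ) ^ k := by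
    intro φ
    have he := hF e'
    induction hz : F.ends e' with
    | h a b =>
    rw [hz, Sym2.mk_isDiag_iff] at he
    induction hz' : (F.ends e).map φ with
    | h y y' =>
    have h1 : ∑ φ' : Fin k ↪ Fin n, (if s(y, y') = s(a, b).map φ' then 1 else 0) ≤
        (Finset.univ.filter fun f : Fin k → Fin n => f a = y ∧ f b = y').card +
        (Finset.univ.filter fun f : Fin k → Fin n => f a = y' ∧ f b = y).card := by
      rw [sum_embedding_eq fun f : Fin k → Fin n => if s(y, y') = s(a, b).map f then 1 else 0,
        Finset.card_filter, Finset.card_filter, ← Finset.sum_add_distrib]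
      refine (Finset.sum_le_sum_of_subset (Finset.filter_subset _ _)).trans
        (Finset.sum_le_sum fun f _ => ?_)
      simp only [Sym2.map_mk, Sym2.eq_iff]
      by_cases hc : f a = y ∧ f b = y'
      · rw [if_pos hc]
        split_ifs <;> omega
      · by_cases hc' : f a = y' ∧ f b = y
        · rw [if_pos hc']
          split_ifs <;> omega
        · rw [if_neg]
          · omega
          · rintro (⟨h1, h2⟩ | ⟨h1, h2⟩)
            · exact hc ⟨h1.symm, h2.symm⟩
            · exact hc' ⟨h2.symm, h1.symm⟩
    have h2 := Nat.mul_le_mul_right (n ^ 2) h1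
    rw [add_mul, card_two_values he, card_two_values he, ← two_mul, mul_comm] at h2
    exact_mod_cast h2
  rw [Finset.mul_sum]
  refine (Finset.sum_le_sum fun φ _ => h φ).trans ?_
  rw [Finset.sum_const, Finset.card_univ, nsmul_eq_mul, Fintype.card_embedding_eq,
    Fintype.card_fin, Fintype.card_fin]
  have : (n.descFactorial k : ℝ) ≤ (n : ℝ) ^ k := by exact_mod_cast Nat.descFactorial_le_pow n k
  calc (n.descFactorial k : ℝ) * (2 * (n : ℝ) ^ k) ≤ (n : ℝ) ^ k * (2 * (n : ℝ) ^ k) := by gcongr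
    _ = 2 * ((n : ℝ) ^ k) ^ 2 := by ring

/-- An overlap of `ψ` and `ψ'` reduces both the number of choices and the powers of `1 / n ^ 2`;
summing by image size gives a bound that is `O(1)` for `m = O(n ^ 2)`. -/
theorem sum_integral_preserves_mul_le [NeZero n] (F : Multigraph (Fin k) (Fin l))
    (φ φ' : Fin k ↪ Fin n) :
    ∑ ψ : Fin l ↪ Fin m, ∑ ψ' : Fin l ↪ Fin m, ∫ x, pairExp (normalized x)
      (fun G => propIndicator (F.Preserves G (φ, ψ)) *
        propIndicator (F.Preserves G (φ', ψ'))) ∂expPi (Fin n) ≤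
      2 ^ (l + l) * (2 * (l + l)).factorial * ((l + l : ℕ) + m * (1 / (n : ℝ) ^ 2)) ^ (l + l) := by
  have h1 : ∀ ψ ψ' : Fin l ↪ Fin m, ∫ x, pairExp (normalized x)
      (fun G => propIndicator (F.Preserves G (φ, ψ)) *
        propIndicator (F.Preserves G (φ', ψ'))) ∂expPi (Fin n) ≤
      2 ^ (l + l) * (2 * (l + l)).factorial *
        (1 / (n : ℝ) ^ 2) ^ (Finset.univ.image (Fin.append ψ ψ')).card := by
    intro ψ ψ'
    simp only [preserves_mul_preserves]
    have := integral_pairExp_ends_le (n := n) (Finset.univ : Finset (Fin (l + l)))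
      (Fin.append ψ ψ') (Fin.append (fun e => (F.ends e).map φ) (fun e => (F.ends e).map φ'))
    rwa [Finset.card_univ, Fintype.card_fin] at this
  refine (Finset.sum_le_sum fun ψ _ => Finset.sum_le_sum fun ψ' _ => h1 ψ ψ').trans ?_
  simp only [← Finset.mul_sum]
  refine mul_le_mul_of_nonneg_left ?_ (by positivity)
  refine le_trans ?_ (sum_pow_card_image_le m (l + l) (by positivity))
  rw [← (Fin.appendEquiv l l).sum_comp, Fintype.sum_prod_type]
  have hnn : ∀ f f' : Fin l → Fin m,
      0 ≤ (1 / (n : ℝ) ^ 2) ^ (Finset.univ.image (Fin.append f f')).card := fun f f' => by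
    positivity
  refine (sum_embedding_le_sum (g := fun f : Fin l → Fin m => ∑ ψ' : Fin l ↪ Fin m,
    (1 / (n : ℝ) ^ 2) ^ (Finset.univ.image (Fin.append f ψ')).card) fun f =>
    Finset.sum_nonneg fun f' _ => hnn f f').trans (Finset.sum_le_sum fun f _ => ?_)
  exact sum_embedding_le_sum (g := fun f' : Fin l → Fin m =>
    (1 / (n : ℝ) ^ 2) ^ (Finset.univ.image (Fin.append f f')).card) (hnn f)

theorem measurable_meanInj (F : Multigraph (Fin k) (Fin l)) :
    Measurable fun x : Fin n → ℝ => F.meanInj m (normalized x) := by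
  unfold meanInj
  refine Measurable.const_mul (Measurable.const_mul ?_ _) _
  exact Finset.measurable_fun_sum _ fun φ _ => Finset.measurable_fun_prod _ fun i _ =>
    (measurable_normalized _).pow_const _

/-- There are `l ^ 2` choices of `(e, e')`, order `n ^ (2k - 2)` compatible pairs of vertex maps for
each, and the preceding bound for each such pair. -/
theorem integral_sub_meanInj_sq_le [NeZero n] {F : Multigraph (Fin k) (Fin l)}
    (hF : F.IsLoopless) :
    Integrable (fun x => pairExp (normalized x) (fun G : Multigraph (Fin n) (Fin m) =>
      ((F.inj G : ℝ) - F.meanInj m (normalized x)) ^ 2)) (expPi (Fin n)) ∧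
    (n : ℝ) ^ 2 * ∫ x, pairExp (normalized x) (fun G : Multigraph (Fin n) (Fin m) =>
      ((F.inj G : ℝ) - F.meanInj m (normalized x)) ^ 2) ∂expPi (Fin n) ≤
      (l : ℝ) ^ 2 * 2 * (2 ^ (l + l) * (2 * (l + l)).factorial *
        ((l + l : ℕ) + m * (1 / (n : ℝ) ^ 2)) ^ (l + l)) * ((n : ℝ) ^ k) ^ 2 := by
  classical
  set K : ℝ := 2 ^ (l + l) * (2 * (l + l)).factorial *
        ((l + l : ℕ) + m * (1 / (n : ℝ) ^ 2)) ^ (l + l) with hK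
  have hK0 : 0 ≤ K := by positivity
  have hi : ∀ (e e' : Fin l) (q q' : (Fin k ↪ Fin n) × (Fin l ↪ Fin m)), Integrable
      (fun x => if (F.ends e).map q.1 = (F.ends e').map q'.1 then
        pairExp (normalized x) (fun G => propIndicator (F.Preserves G q) *
          propIndicator (F.Preserves G q')) else (0 : ℝ)) (expPi (Fin n)) := by
    intro e e' q q'
    split_ifs
    · exact integrable_pairExp _
    · exact integrable_zero _ _ _
  have hdom := integrable_finsetSum Finset.univ fun e _ =>
    integrable_finsetSum Finset.univ fun e' _ => integrable_finsetSum Finset.univ fun q _ =>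
    integrable_finsetSum Finset.univ fun q' _ => hi e e' q q'
  have hpt := fun (x : Fin n → ℝ) (hx : ∀ v, 0 < x v) =>
    pairExp_sub_meanInj_sq_le (m := m) hF (normalized_nonneg hx) (sum_normalized hx)
  have hle := ae_expPi_pos.mono hpt
  have h0 : ∀ᵐ x ∂expPi (Fin n), 0 ≤ pairExp (normalized x)
      (fun G : Multigraph (Fin n) (Fin m) =>
        ((F.inj G : ℝ) - F.meanInj m (normalized x)) ^ 2) := by
    filter_upwards [ae_expPi_pos] with x hx using
      pairExp_nonneg (normalized_nonneg hx) fun G => sq_nonneg _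
  refine ⟨hdom.mono' ?_ ?_, ?_⟩
  · refine Measurable.aestronglyMeasurable (Finset.measurable_fun_sum _ fun u _ => ?_)
    exact (Finset.measurable_fun_prod _ fun j _ => measurable_normalized _).mul
      ((measurable_const.sub F.measurable_meanInj).pow_const 2)
  · filter_upwards [hle, h0] with x h1 h2
    rwa [Real.norm_of_nonneg h2]
  have h1 : ∫ x, pairExp (normalized x) (fun G : Multigraph (Fin n) (Fin m) =>
      ((F.inj G : ℝ) - F.meanInj m (normalized x)) ^ 2) ∂expPi (Fin n) ≤
      ∑ e, ∑ e', ∑ q : (Fin k ↪ Fin n) × (Fin l ↪ Fin m),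
        ∑ q' : (Fin k ↪ Fin n) × (Fin l ↪ Fin m),
        if (F.ends e).map q.1 = (F.ends e').map q'.1 then
          ∫ x, pairExp (normalized x) (fun G => propIndicator (F.Preserves G q) *
            propIndicator (F.Preserves G q')) ∂expPi (Fin n) else 0 := by
    refine (integral_mono_of_nonneg h0 hdom hle).trans (le_of_eq ?_)
    rw [integral_finsetSum _ fun e _ => integrable_finsetSum Finset.univ fun e' _ =>
      integrable_finsetSum Finset.univ fun q _ => integrable_finsetSum Finset.univ fun q' _ => hi e e' q q']
    refine Finset.sum_congr rfl fun e _ => ?_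
    rw [integral_finsetSum _ fun e' _ =>
      integrable_finsetSum Finset.univ fun q _ => integrable_finsetSum Finset.univ fun q' _ => hi e e' q q']
    refine Finset.sum_congr rfl fun e' _ => ?_
    rw [integral_finsetSum _ fun q _ => integrable_finsetSum Finset.univ fun q' _ => hi e e' q q']
    refine Finset.sum_congr rfl fun q _ => ?_
    rw [integral_finsetSum _ fun q' _ => hi e e' q q']
    refine Finset.sum_congr rfl fun q' _ => ?_
    split_ifs <;> simp
  have h2 : ∀ e e' : Fin l, (n : ℝ) ^ 2 * ∑ q : (Fin k ↪ Fin n) × (Fin l ↪ Fin m),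
        ∑ q' : (Fin k ↪ Fin n) × (Fin l ↪ Fin m),
        (if (F.ends e).map q.1 = (F.ends e').map q'.1 then
          ∫ x, pairExp (normalized x) (fun G => propIndicator (F.Preserves G q) *
            propIndicator (F.Preserves G q')) ∂expPi (Fin n) else 0) ≤
      2 * K * ((n : ℝ) ^ k) ^ 2 := by
    intro e e'
    have h3 : ∑ q : (Fin k ↪ Fin n) × (Fin l ↪ Fin m),
        ∑ q' : (Fin k ↪ Fin n) × (Fin l ↪ Fin m),
        (if (F.ends e).map q.1 = (F.ends e').map q'.1 then
          ∫ x, pairExp (normalized x) (fun G => propIndicator (F.Preserves G q) *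
            propIndicator (F.Preserves G q')) ∂expPi (Fin n) else 0) ≤
        ∑ φ : Fin k ↪ Fin n, ∑ φ' : Fin k ↪ Fin n,
          (if (F.ends e).map φ = (F.ends e').map φ' then 1 else 0) * K := by
      rw [Fintype.sum_prod_type]
      simp only [Fintype.sum_prod_type]
      refine Finset.sum_le_sum fun φ _ => ?_
      -- Both vertex maps come outermost, so that compatibility is decided before the edge maps are
      -- summed.
      rw [Finset.sum_comm]
      refine Finset.sum_le_sum fun φ' _ => ?_
      split_ifs
      · rw [one_mul]
        exact F.sum_integral_preserves_mul_le φ φ'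
      · simp
    refine (mul_le_mul_of_nonneg_left h3 (by positivity)).trans ?_
    simp only [← Finset.sum_mul]
    rw [← mul_assoc, mul_right_comm 2 K]
    exact mul_le_mul_of_nonneg_right (sum_compatible_le hF e e') hK0
  refine (mul_le_mul_of_nonneg_left h1 (by positivity)).trans ?_
  rw [Finset.mul_sum]
  simp only [Finset.mul_sum (s := (Finset.univ : Finset (Fin l)))]
  refine (Finset.sum_le_sum fun e _ => Finset.sum_le_sum fun e' _ => h2 e e').trans (le_of_eq ?_)
  simp only [Finset.sum_const, Finset.card_univ, Fintype.card_fin, nsmul_eq_mul]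
  ring

end Multigraph

/-! ### Complete convergence of the injective homomorphism densities -/

namespace Multigraph

variable {k l : ℕ}

/-- Provides the countability of the `F` needed for one common null set. -/
instance {V E : Type*} [Finite V] [Finite E] : Finite (Multigraph V E) :=
  Finite.of_injective Multigraph.ends fun _ _ h => Multigraph.ext h

/-- A deviation of `ε` from `τ` forces one of `ε / 2` either between the conditional mean and `τ`,
or between the density and its conditional mean; Chebyshev handles the latter and produces `4 / ε ^
2`. -/
theorem toMeasure_PAG_tInj_le {n m : ℕ} [NeZero n] {F : Multigraph (Fin k) (Fin l)}
    (hF : F.IsLoopless) (τ : ℝ) {ε : ℝ} (hε : 0 < ε) :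
    (PAG n m).toMeasure {g | ε ≤ |F.tInj g - τ|} ≤
      expPi (Fin n) {x | ε / 2 ≤ |F.meanInj m (normalized x) / (n.descFactorial k : ℝ) - τ|} +
      ENNReal.ofReal (4 / ε ^ 2 * ((l : ℝ) ^ 2 * 2 * (2 ^ (l + l) * (2 * (l + l)).factorial *
        ((l + l : ℕ) + m * (1 / (n : ℝ) ^ 2)) ^ (l + l)) *
        ((n : ℝ) ^ k / (n.descFactorial k : ℝ)) ^ 2) * (1 / (n : ℝ) ^ 2)) := by
  set A : Set (Fin n → ℝ) :=
    {x | ε / 2 ≤ |F.meanInj m (normalized x) / (n.descFactorial k : ℝ) - τ|} with hA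
  set D : ℝ := (n.descFactorial k : ℝ) with hD
  set C : ℝ := (l : ℝ) ^ 2 * 2 * (2 ^ (l + l) * (2 * (l + l)).factorial *
        ((l + l : ℕ) + m * (1 / (n : ℝ) ^ 2)) ^ (l + l)) with hC
  set v : (Fin n → ℝ) → ℝ := fun x => pairExp (normalized x)
    (fun G : Multigraph (Fin n) (Fin m) => ((F.inj G : ℝ) - F.meanInj m (normalized x)) ^ 2)
    with hv
  have hAm : MeasurableSet A :=
    measurableSet_le measurable_const (((F.measurable_meanInj.div_const _).sub_const _).abs)
  obtain ⟨hint, hvar⟩ : Integrable v (expPi (Fin n)) ∧ _ := integral_sub_meanInj_sq_le hF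
  have hn : (0 : ℝ) < n := by exact_mod_cast NeZero.pos n
  have hv0 : ∀ᵐ x ∂expPi (Fin n), 0 ≤ 4 / ε ^ 2 / D ^ 2 * v x := by
    filter_upwards [ae_expPi_pos] with x hx
    exact mul_nonneg (by positivity) (pairExp_nonneg (normalized_nonneg hx) fun G => sq_nonneg _)
  have hpt : ∀ᵐ x ∂expPi (Fin n), ENNReal.ofReal (pairExp (normalized x)
      (fun g : Multigraph (Fin n) (Fin m) => propIndicator (g ∈ {g | ε ≤ |F.tInj g - τ|}))) ≤
      A.indicator 1 x + ENNReal.ofReal (4 / ε ^ 2 / D ^ 2 * v x) := by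
    filter_upwards [ae_expPi_pos, hv0] with x hx hvx
    have hp := normalized_nonneg hx
    by_cases hxA : x ∈ A
    · rw [Set.indicator_of_mem hxA]
      refine le_trans ?_ le_self_add
      rw [Pi.one_apply, ← ENNReal.ofReal_one]
      refine ENNReal.ofReal_le_ofReal ?_
      rw [← pairExp_one (m := m) (sum_normalized hx)]
      refine pairExp_mono hp fun g => ?_
      rw [← propIndicator_of_true trivial]
      exact propIndicator_mono fun _ => trivial
    · rw [Set.indicator_of_notMem hxA, zero_add]
      refine ENNReal.ofReal_le_ofReal ?_
      rw [hv, ← pairExp_const_mul]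
      refine pairExp_mono hp fun g => ?_
      by_cases hg : ε ≤ |F.tInj g - τ|
      · rw [propIndicator_of_true hg]
        have h1 : ε / 2 ≤ |F.tInj g - F.meanInj m (normalized x) / D| := by
          have h2 : |F.meanInj m (normalized x) / D - τ| < ε / 2 := not_le.1 hxA
          have h3 := abs_add_le (F.tInj g - F.meanInj m (normalized x) / D)
            (F.meanInj m (normalized x) / D - τ)
          rw [sub_add_sub_cancel] at h3
          linarith
        have h4 := pow_le_pow_left₀ (by positivity) h1 2
        rw [sq_abs] at h4
        have h5 : F.tInj g - F.meanInj m (normalized x) / D =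
            ((F.inj g : ℝ) - F.meanInj m (normalized x)) / D := by
          rw [tInj, Nat.card_fin, Nat.card_fin, sub_div]
        rw [h5, div_pow, div_pow] at h4
        calc (1 : ℝ) = 4 / ε ^ 2 * (ε ^ 2 / 2 ^ 2) := by field_simp; norm_num
          _ ≤ 4 / ε ^ 2 * (((F.inj g : ℝ) - F.meanInj m (normalized x)) ^ 2 / D ^ 2) := by gcongr
          _ = _ := by ring
      · rw [propIndicator_of_false hg]
        positivity
  rw [toMeasure_PAG, ofReal_integral_eq_lintegral_ofReal (integrable_pairExp _)
    (by filter_upwards [ae_expPi_pos] with x hx using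
      pairExp_nonneg (normalized_nonneg hx) fun g => propIndicator_nonneg _)]
  refine (lintegral_mono_ae hpt).trans ?_
  rw [lintegral_add_left (measurable_one.indicator hAm), lintegral_indicator_one hAm,
    ← ofReal_integral_eq_lintegral_ofReal (hint.const_mul _) hv0, integral_const_mul]
  refine add_le_add le_rfl (ENNReal.ofReal_le_ofReal ?_)
  have h6 : ∫ x, v x ∂expPi (Fin n) ≤ C * ((n : ℝ) ^ k) ^ 2 / (n : ℝ) ^ 2 := by
    rw [le_div_iff₀' (by positivity)]
    exact hvar
  calc 4 / ε ^ 2 / D ^ 2 * ∫ x, v x ∂expPi (Fin n)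
      ≤ 4 / ε ^ 2 / D ^ 2 * (C * ((n : ℝ) ^ k) ^ 2 / (n : ℝ) ^ 2) := by gcongr
    _ = _ := by ring

/-- The first error is summable by complete convergence of the conditional mean, the second because
it is a convergent sequence times `1 / n ^ 2`. The shift to `n + 1` keeps the vertex set nonempty.
-/
theorem tsum_toMeasure_PAG_tInj_ne_top {c : ℝ} {m : ℕ → ℕ}
    (hm : Tendsto (fun n : ℕ => (m n : ℝ) / (n : ℝ) ^ 2) atTop (𝓝 (c / 2)))
    {F : Multigraph (Fin k) (Fin l)} (hF : F.IsLoopless) {ε : ℝ} (hε : 0 < ε) :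
    ∑' n : ℕ, (PAG (n + 1) (m (n + 1))).toMeasure {g | ε ≤ |F.tInj g - F.t (logKernel c)|} ≠ ⊤ := by
  have hτ : F.t (logKernel c) = c ^ l * ∏ i, ((F.degree i).factorial : ℝ) := by
    rw [t_logKernel, Fintype.card_fin]
  have h1 := tendsto_normalized_sum hm (l := l) (r := F.degree) (by
    rw [F.sum_degree, Fintype.card_fin])
  rw [← hτ, Metric.tendsto_nhds] at h1
  have h2 := h1 (ε / 2) (half_pos hε)
  rw [Filter.Eventually, expFilter, mem_completeFilter] at h2
  set C : ℕ → ℝ := fun n => (l : ℝ) ^ 2 * 2 * (2 ^ (l + l) * (2 * (l + l)).factorial *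
        ((l + l : ℕ) + m n * (1 / (n : ℝ) ^ 2)) ^ (l + l)) *
        ((n : ℝ) ^ k / (n.descFactorial k : ℝ)) ^ 2 with hC
  obtain ⟨L, hL⟩ : ∃ L, Tendsto C atTop (𝓝 L) := by
    have h3 : Tendsto (fun n : ℕ => (n : ℝ) ^ k / (n.descFactorial k : ℝ)) atTop (𝓝 1) := by
      simpa using (tendsto_descFactorial_self k).inv₀ one_ne_zero
    have h4 : Tendsto (fun n : ℕ => (m n : ℝ) * (1 / (n : ℝ) ^ 2)) atTop (𝓝 (c / 2)) := by
      simpa [div_eq_mul_inv] using hm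
    exact ⟨_, (((((h4.const_add _).pow _).const_mul _).const_mul _).mul (h3.pow 2))⟩
  have hs : Summable fun n : ℕ => 4 / ε ^ 2 * C n * (1 / (n : ℝ) ^ 2) := by
    refine summable_of_isBigO_nat (Real.summable_one_div_nat_pow.2 one_lt_two) ?_
    simpa only [one_mul] using ((hL.const_mul (4 / ε ^ 2)).isBigO_one ℝ).mul
      (Asymptotics.isBigO_refl (fun n : ℕ => 1 / (n : ℝ) ^ 2) atTop)
  refine ne_top_of_le_ne_top (ENNReal.add_ne_top.2 ⟨ne_top_of_le_ne_top h2
      (ENNReal.tsum_comp_le_tsum_of_injective (add_left_injective 1) _),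
    ((summable_nat_add_iff 1).2 hs).tsum_ofReal_ne_top⟩) ?_
  rw [← ENNReal.tsum_add]
  refine ENNReal.tsum_le_tsum fun n => ?_
  refine (toMeasure_PAG_tInj_le hF _ hε).trans (add_le_add (measure_mono fun x hx => ?_) le_rfl)
  simpa [Real.dist_eq, meanInj] using hx

/-- The first Borel–Cantelli lemma needs no independence, so only the marginal laws matter; it is
applied for each `1 / (j + 1)`. -/
theorem ae_tendsto_tInj {c : ℝ} {m : ℕ → ℕ}
    (hm : Tendsto (fun n : ℕ => (m n : ℝ) / (n : ℝ) ^ 2) atTop (𝓝 (c / 2)))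
    {Ω : Type*} [MeasurableSpace Ω] {P : Measure Ω}
    {G : (n : ℕ) → Ω → Multigraph (Fin n) (Fin (m n))}
    (hG : ∀ (n : ℕ) [NeZero n], HasLaw (G n) (PAG n (m n)).toMeasure P)
    {F : Multigraph (Fin k) (Fin l)} (hF : F.IsLoopless) :
    ∀ᵐ ω ∂P, Tendsto (fun n => F.tInj (G n ω)) atTop (𝓝 (F.t (logKernel c))) := by
  have h : ∀ j : ℕ, ∀ᵐ ω ∂P, ∀ᶠ n : ℕ in atTop,
      |F.tInj (G (n + 1) ω) - F.t (logKernel c)| < 1 / ((j : ℝ) + 1) := by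
    intro j
    have hlaw : ∀ n : ℕ, P {ω | 1 / ((j : ℝ) + 1) ≤
        |F.tInj (G (n + 1) ω) - F.t (logKernel c)|} = (PAG (n + 1) (m (n + 1))).toMeasure
        {g | 1 / ((j : ℝ) + 1) ≤ |F.tInj g - F.t (logKernel c)|} := by
      intro n
      rw [← (hG (n + 1)).map_eq, Measure.map_apply_of_aemeasurable (hG (n + 1)).aemeasurable
        (by trivial)]
      rfl
    have hsum := tsum_toMeasure_PAG_tInj_ne_top hm hF (ε := 1 / ((j : ℝ) + 1)) (by positivity)
    simp only [← hlaw] at hsum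
    filter_upwards [ae_eventually_notMem hsum] with ω hω
    filter_upwards [hω] with n hn using not_le.1 hn
  filter_upwards [ae_all_iff.2 h] with ω hω
  -- The graph at `n = 0`, whose law is not prescribed, is discarded.
  rw [← tendsto_add_atTop_iff_nat 1, Metric.tendsto_nhds]
  intro ε hε
  obtain ⟨j, hj⟩ := exists_nat_one_div_lt hε
  filter_upwards [hω j] with n hn
  rw [Real.dist_eq]
  exact hn.trans hj

end Multigraph

theorem proposition3p5 (c : ℝ) (m : ℕ → ℕ)
    (hm : Tendsto (fun n : ℕ => (m n : ℝ) / (n : ℝ) ^ 2) atTop (𝓝 (c / 2)))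
    {Ω : Type*} [MeasurableSpace Ω] (P : Measure Ω) [IsProbabilityMeasure P]
    (G : (n : ℕ) → Ω → Multigraph (Fin n) (Fin (m n)))
    (hG : ∀ (n : ℕ) [NeZero n], HasLaw (G n) (PAG n (m n)).toMeasure P) :
    (∀ (k l : ℕ) (F : Multigraph (Fin k) (Fin l)), F.IsLoopless →
      IntegrableOn (F.edgeProd (logKernel c)) (Set.Icc 0 1) ∧
      F.t (logKernel c) = c ^ l * ∏ i, ((F.degree i).factorial : ℝ)) ∧
    ∀ᵐ ω ∂P, ∀ (k l : ℕ) (F : Multigraph (Fin k) (Fin l)), F.IsLoopless →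
      Tendsto (fun n => F.tInj (G n ω)) atTop (𝓝 (F.t (logKernel c))) := by
  refine ⟨fun k l F _ => ⟨F.integrableOn_edgeProd_logKernel c, ?_⟩, ?_⟩
  · rw [F.t_logKernel, Fintype.card_fin]
  · simp only [ae_all_iff]
    exact fun k l F hF => Multigraph.ae_tendsto_tInj hm hG hF
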